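/- Let $N\ge 2$, $p\ge 1$, $h>0$, let $H,W\ge 0$ be integers, let $S\le O(2)$ be a finite subgroup with $|S|=t$, and let $A_\theta$ denote the rotation by $\theta$. For $a,b\in\mathbb N$ let the centred $a\times b$ grid consist of the points $\big((k-\frac{a+1}{2})h,(l-\frac{b+1}{2})h\big)$, $1\le k\le a$, $1\le l\le b$; let $\Lambda$ be the centred $p\times p$ grid, and $x_{kl}$ the points of the centred $H\times W$ grid. Let $c_0,\dots,c_N\in\mathbb N$ and consider the $N$-layer equivariant ReLU network $g$ with filters $\varphi^1_{ad}$, $\varphi^i_{A,ad}$ ($2\le i\le N-1$, $A\in S$), $\varphi^N_{ad}:\mathbb R^2\to\mathbb R$ (with $1\le a\le c_{i-1}$, $1\le d\le c_i$ in layer $i$). It maps the latent functions $r=(r_a)_{1\le a\le c_0}$, $r_a:\mathbb R^2\to\mathbb R$, of an image $I=(r_a(x_{kl}))$ to functions $g[r]_d$, $1\le d\le c_N$, given with $\sigma(s)=\max(s,0)$ by $$e^1_d(x,B)=\sigma\Big(\sum_{a}\sum_{\delta\in\Lambda}\varphi^1_{ad}(B^{-1}\delta)\,r_a(x-\delta)\Big),$$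 $$e^i_d(x,B)=\sigma\Big(\sum_{a}\sum_{A\in S}\sum_{\delta\in\Lambda}\varphi^i_{A,ad}(B^{-1}\delta)\,e^{i-1}_a(x-\delta,BA)\Big)\quad(2\le i\le N-1),$$ $$g[r]_d(x)=\sum_{a}\sum_{B\in S}\sum_{\delta\in\Lambda}\varphi^N_{ad}(B^{-1}\delta)\,e^{N-1}_a(x-\delta,B),$$ where $x\in\mathbb R^2$, $B\in S$; the output image is $g(I)=(g[r]_d(x_{kl}))$. The channel numbers are $n_0=c_0$ and $n_i=t\,c_i$ for $1\le i\le N-1$. For $\theta\in\mathbb R$ and $b\in\mathbb R^2$ let $f_{\theta b}[r](x)=r(A_\theta^{-1}(x-b))$, with inverse $f_{\theta b}^{-1}[r](x)=r(A_\theta x+b)$, acting on each channel; $\tilde f_{\theta b}$ and $\tilde f_{\theta b}^{-1}$ denote the induced operations on sampled images, i.e. the latent functions are transformed and then sampled at the points $x_{kl}$. Assume that all $r_a$ and all filters are $C^2$ and that there are constants $F_0,G_0,H_0$ and $F_i>0$, $G_i$, $H_i$ ($1\le i\le N$) such that for all $x\in\mathbb R^2$ and all channels $$|r_a(x)|\le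 F_0,\quad \|\nabla r_a(x)\|\le G_0,\quad \|\nabla^2 r_a(x)\|\le H_0,$$ and every filter $\varphi^i$ of layer $i$ satisfies $$|\varphi^i(x)|\le F_i,\quad \|\nabla\varphi^i(x)\|\le G_i,\quad \|\nabla^2\varphi^i(x)\|\le H_i,\qquad \varphi^i(x)=0\ \text{ if }\ \|x\|\ge \tfrac{(p+1)h}{2}$$ (Euclidean norm of gradients, operator norm of Hessians). Then for all $\theta\in[0,2\pi]$, all $b\in\mathbb R^2$, and at every grid point and in every output channel, $$\Big|\tilde f_{\theta b}^{-1}\,g\big(\tilde f_{\theta b}I\big)-g(I)\Big|\le C_1h^2+C_2\,p\,h\,t^{-1},$$ that is, $\big|f_{\theta b}^{-1}\big[g[f_{\theta b}[r]]\big]_d(x_{kl})-g[r]_d(x_{kl})\big|\le C_1h^2+C_2\,p\,h\,t^{-1}$ for all $k,l,d$, where $$C_1=2N\mathcal F\sum_{i=1}^N\Big(\frac{H_iF_0}{F_i}+2\frac{G_i}{F_i}\sum_{m=1}^{i-1}\frac{G_mF_0}{F_m}+2\frac{G_iG_0}{F_i}+H_0\Big),$$ $$C_2=2\pi G_0\mathcal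 F\big(2\max\{H,W\}\,p^{-1}+2N\big),\qquad \mathcal F=\prod_{i=1}^N n_{i-1}p^2F_i .$$ -/

import Mathlib

/-- The plane `ℝ²` with its Euclidean norm. -/
abbrev Plane : Type := EuclideanSpace ℝ (Fin 2)

/-- The orthogonal group `O(2)`, as a group of real `2 × 2` matrices. -/
abbrev O2 : Type := ↥(Matrix.orthogonalGroup (Fin 2) ℝ)

/-- The action of an orthogonal matrix on a vector of the plane. -/
noncomputable def actO2 (A : O2) (x : Plane) : Plane :=
  WithLp.toLp 2 ((A : Matrix (Fin 2) (Fin 2) ℝ).mulVec (WithLp.ofLp x))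

theorem actO2_mul (A B : O2) (x : Plane) : actO2 (A * B) x = actO2 A (actO2 B x) := by
  simp only [actO2, Submonoid.coe_mul, Matrix.mulVec_mulVec]

theorem actO2_one (x : Plane) : actO2 1 x = x := by
  simp [actO2]

/-- The rotation matrix `A_θ` with rows `(cos θ, -sin θ)` and `(sin θ, cos θ)`. -/
noncomputable def rotO2 (θ : ℝ) : O2 :=
  ⟨!![Real.cos θ, -Real.sin θ; Real.sin θ, Real.cos θ], by
    rw [Matrix.mem_orthogonalGroup_iff]
    ext i j
    fin_cases i <;> fin_cases j <;>
      simp [Matrix.mul_apply, Fin.sum_univ_two] <;>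
      nlinarith [Real.sin_sq_add_cos_sq θ]⟩

/-- Latent functions of an image with `n` channels: one function on the plane per channel. -/
abbrev Latent (n : ℕ) : Type := Fin n → Plane → ℝ

/-- The rigid motion by the rotation `A_θ` and the translation `b`, acting on each channel:
`f_{θ b}[r](x) = r (A_θ⁻¹ (x - b))`. -/
noncomputable def transform {n : ℕ} (θ : ℝ) (b : Plane) (r : Latent n) : Latent n :=
  fun c x => r c (actO2 (rotO2 θ)⁻¹ (x - b))

/-- The inverse of `transform θ b`: `f_{θ b}⁻¹[r](x) = r (A_θ x + b)`. -/
noncomputable def transformInv {n : ℕ} (θ : ℝ) (b : Plane) (r : Latent n) : Latent n :=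
  fun c x => r c (actO2 (rotO2 θ) x + b)

theorem transformInv_transform {n : ℕ} (θ : ℝ) (b : Plane) (r : Latent n) :
    transformInv θ b (transform θ b r) = r := by
  funext c x
  simp [transformInv, transform, ← actO2_mul, actO2_one]

theorem transform_transformInv {n : ℕ} (θ : ℝ) (b : Plane) (r : Latent n) :
    transform θ b (transformInv θ b r) = r := by
  funext c x
  simp [transformInv, transform, ← actO2_mul, actO2_one]

/-- The centred grid of mesh size `h`: for `k = 1, …, H` and `l = 1, …, W` (here `0`-based), the
point `((k - (H+1)/2) h, (l - (W+1)/2) h)`. -/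
noncomputable def gridPoint (H W : ℕ) (h : ℝ) (k : Fin H) (l : Fin W) : Plane :=
  !₂[((k : ℝ) + 1 - ((H : ℝ) + 1) / 2) * h, ((l : ℝ) + 1 - ((W : ℝ) + 1) / 2) * h]

/-- The `H × W × n` array obtained by sampling latent functions on the grid. -/
noncomputable def sample (H W : ℕ) (h : ℝ) {n : ℕ} (r : Latent n) :
    Fin H → Fin W → Fin n → ℝ :=
  fun k l c => r c (gridPoint H W h k l)

/-- The rectified linear unit. -/
noncomputable def relu (s : ℝ) : ℝ := max s 0

/-- The (latent) filters of an `N`-layer equivariant network for the group `S`, with `c i` feature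
channels (each of them carrying one value per group element when `1 ≤ i ≤ N - 1`) after layer `i`.
Layer `1` is the input layer, layer `N` the output layer, and only the members `mid i` with
`2 ≤ i ≤ N - 1` of the family `mid` are used. -/
structure EquivariantNet (S : Subgroup O2) (N : ℕ) (c : ℕ → ℕ) where
  /-- `φ¹_{c d}` -/
  input : Fin (c 0) → Fin (c 1) → Plane → ℝ
  /-- `φⁱ_{A c d}` -/
  mid : (i : ℕ) → S → Fin (c (i - 1)) → Fin (c i) → Plane → ℝ
  /-- `φᴺ_{c d}` -/
  output : Fin (c (N - 1)) → Fin (c N) → Plane → ℝ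

namespace EquivariantNet

variable {S : Subgroup O2} [Fintype S] {N : ℕ} {c : ℕ → ℕ}

/-- The latent feature map `e^i_d(x, B)` after layer `i` and its activation, for `1 ≤ i ≤ N - 1`,
with filters sampled on the `p × p` grid of mesh size `h`; the value at `i = 0` is a dummy. -/
noncomputable def feature (g : EquivariantNet S N c) (p : ℕ) (h : ℝ) (r : Latent (c 0)) :
    (i : ℕ) → Fin (c i) → Plane → S → ℝ
  | 0 => fun _ _ _ => 0
  | 1 => fun d x B => relu (∑ a : Fin (c 0), ∑ k : Fin p, ∑ l : Fin p,
      g.input a d (actO2 (B : O2)⁻¹ (gridPoint p p h k l)) * r a (x - gridPoint p p h k l))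
  | i + 2 => fun d x B => relu (∑ a : Fin (c (i + 1)), ∑ A : S, ∑ k : Fin p, ∑ l : Fin p,
      g.mid (i + 2) A a d (actO2 (B : O2)⁻¹ (gridPoint p p h k l)) *
        feature g p h r (i + 1) a (x - gridPoint p p h k l) (B * A))

/-- The latent output of the network; the output layer is not followed by an activation. -/
noncomputable def eval (g : EquivariantNet S N c) (p : ℕ) (h : ℝ) (r : Latent (c 0)) :
    Latent (c N) :=
  fun d x => ∑ a : Fin (c (N - 1)), ∑ B : S, ∑ k : Fin p, ∑ l : Fin p,
    g.output a d (actO2 (B : O2)⁻¹ (gridPoint p p h k l)) *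
      g.feature p h r (N - 1) a (x - gridPoint p p h k l) B

end EquivariantNet

/-- `f` is twice continuously differentiable and `|f| ≤ F`, `‖∇f‖ ≤ G`, `‖∇²f‖ ≤ D` everywhere
(with the Euclidean norm of the gradient and the operator norm of the Hessian). -/
def BoundedC2 (f : Plane → ℝ) (F G D : ℝ) : Prop :=
  ContDiff ℝ 2 f ∧
    ∀ x, |f x| ≤ F ∧ ‖fderiv ℝ f x‖ ≤ G ∧ ‖fderiv ℝ (fderiv ℝ f) x‖ ≤ D

/-- A filter: bounds as above, and `f x = 0` for `‖x‖ ≥ (p + 1) h / 2`. -/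
def FilterBound (p : ℕ) (h : ℝ) (f : Plane → ℝ) (F G D : ℝ) : Prop :=
  BoundedC2 f F G D ∧ ∀ x, ((p : ℝ) + 1) * h / 2 ≤ ‖x‖ → f x = 0

/-- Every filter of the `i`-th layer obeys the bounds `F i`, `G i`, `D i`. -/
def EquivariantNet.Bounded {S : Subgroup O2} {N : ℕ} {c : ℕ → ℕ} (g : EquivariantNet S N c)
    (p : ℕ) (h : ℝ) (F G D : ℕ → ℝ) : Prop :=
  (∀ a d, FilterBound p h (g.input a d) (F 1) (G 1) (D 1)) ∧
  (∀ i, 2 ≤ i → i + 1 ≤ N → ∀ A a d, FilterBound p h (g.mid i A a d) (F i) (G i) (D i)) ∧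
  (∀ a d, FilterBound p h (g.output a d) (F N) (G N) (D N))

/-- The channel number `n_i` of layer `i` of an `N`-layer network: the image (`i = 0`) and the
output (`i = N`) have `c i` channels, while a feature map with `c i` channels over a group of
order `t` counts as `t * c i` channels. -/
def channelNumber (N t : ℕ) (c : ℕ → ℕ) (i : ℕ) : ℕ :=
  if i = 0 ∨ i = N then c i else t * c i

/-- `𝓕 = ∏_{i=1}^N n_{i-1} p² F_i`. -/
noncomputable def prodF (N p : ℕ) (n : ℕ → ℕ) (F : ℕ → ℝ) : ℝ :=
  ∏ i ∈ Finset.Icc 1 N, (n (i - 1) : ℝ) * (p : ℝ) ^ 2 * F i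

/-- The constant `C₁`. -/
noncomputable def constC1 (N p : ℕ) (n : ℕ → ℕ) (F G D : ℕ → ℝ) : ℝ :=
  2 * (N : ℝ) * prodF N p n F * ∑ i ∈ Finset.Icc 1 N,
    (D i * F 0 / F i + 2 * (G i / F i) * (∑ m ∈ Finset.Icc 1 (i - 1), G m * F 0 / F m)
      + 2 * (G i * G 0 / F i) + D 0)

/-- The constant `C₂`. -/
noncomputable def constC2 (N p H W : ℕ) (n : ℕ → ℕ) (F G : ℕ → ℝ) : ℝ :=
  2 * Real.pi * G 0 * prodF N p n F * (2 * max (H : ℝ) (W : ℝ) * (p : ℝ)⁻¹ + 2 * (N : ℝ))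

/-! The network is compared with its continuum version `contEval`, in which each sum over the grid
becomes `h⁻²` times an integral over the plane. That network commutes exactly with translations and
with `S`: for a motion with linear part `s ∈ S`, the substitution `y ↦ s y` in the integrals turns
the motion into the relabelling `B ↦ s B` of the group variable, and the output layer sums over that
variable. Some rotation in `S` lies within angle `2π/t` of `A_θ` (`exists_norm_rotO2_sub_le`).
Replacing `A_θ` by it moves the points of a filter's support by at most `(2π/t) p h`, so each layer
costs this distance times the Lipschitz constant of its input (`IsKernel.abs_contConv_motion_le`).
This gives the `C₂` term.

The `C₁ h²` term is quadrature error, incurred once for the original image and once for the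
transformed one. The midpoint rule is of second order for smooth integrands, but ReLU destroys
second derivatives. What survives is a one-sided bound: ReLU preserves semiconvexity. Second
differences of a semiconvex function are bounded below, and their sum against `|φ|` is bounded above
after summation by parts, which uses only Lipschitz constants. Together the two bounds control the
sum of the absolute node errors at order `h²` (`IsSemiconvex.abs_secondDiff_le`,
`IsKernel.abs_sum_node_le`). Semiconvexity constants do not accumulate through the layers, because
in a convolution the second difference can be moved onto the filter
(`IsKernel.isSemiconvex_contConv`).

Comparing the area of the supporting disc with `p² h²` requires `p ≥ 8`. For `p ≤ 7` no comparison
is needed: a filter with bounded Hessian supported in a disc of radius `O(h)` is itself `O(h²)`,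
hence so are both outputs (`abs_eval_le_of_small`). -/

/-! ### The orthogonal action on the plane -/

theorem norm_actO2 (A : O2) (x : Plane) : ‖actO2 A x‖ = ‖x‖ := by
  have hA := (Matrix.mem_orthogonalGroup_iff' (Fin 2) ℝ).1 A.2
  have e (i j : Fin 2) := congrFun (congrFun hA i) j
  have e00 := e 0 0
  have e01 := e 0 1
  have e11 := e 1 1
  simp [Matrix.mul_apply, Fin.sum_univ_two] at e00 e01 e11
  rw [EuclideanSpace.norm_eq, EuclideanSpace.norm_eq]
  congr 1
  simp only [actO2, Matrix.mulVec, dotProduct, Fin.sum_univ_two, Real.norm_eq_abs, sq_abs]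
  linear_combination (x 0) ^ 2 * e00 + 2 * x 0 * x 1 * e01 + (x 1) ^ 2 * e11

theorem actO2_add (A : O2) (x y : Plane) : actO2 A (x + y) = actO2 A x + actO2 A y := by
  simp only [actO2, WithLp.ofLp_add, Matrix.mulVec_add, WithLp.toLp_add]

theorem actO2_sub (A : O2) (x y : Plane) : actO2 A (x - y) = actO2 A x - actO2 A y := by
  simp only [actO2, WithLp.ofLp_sub, Matrix.mulVec_sub, WithLp.toLp_sub]

theorem actO2_smul (A : O2) (s : ℝ) (x : Plane) : actO2 A (s • x) = s • actO2 A x := by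
  simp only [actO2, WithLp.ofLp_smul, Matrix.mulVec_smul, WithLp.toLp_smul]

theorem actO2_inv_self (A : O2) (x : Plane) : actO2 A⁻¹ (actO2 A x) = x := by
  rw [← actO2_mul, inv_mul_cancel, actO2_one]

theorem actO2_self_inv (A : O2) (x : Plane) : actO2 A (actO2 A⁻¹ x) = x := by
  rw [← actO2_mul, mul_inv_cancel, actO2_one]

/-- The action of an orthogonal matrix as a linear isometry equivalence. -/
noncomputable def isometryO2 (A : O2) : Plane ≃ₗᵢ[ℝ] Plane where
  toFun := actO2 A
  invFun := actO2 A⁻¹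
  left_inv := actO2_inv_self A
  right_inv := actO2_self_inv A
  map_add' := actO2_add A
  map_smul' := actO2_smul A
  norm_map' := norm_actO2 A

theorem continuous_actO2 (A : O2) : Continuous (actO2 A) := (isometryO2 A).continuous

theorem integral_comp_actO2 (A : O2) (f : Plane → ℝ) : ∫ y, f (actO2 A y) = ∫ y, f y :=
  (isometryO2 A).measurePreserving.integral_comp
    (isometryO2 A).toHomeomorph.measurableEmbedding f

/-! ### Two-sided second-order bounds without derivatives -/

/-- `|f| ≤ U`, the function `f` is `V`-Lipschitz, and the deviation of `f` from being affine on
segments is controlled as if `‖∇²f‖ ≤ L`. -/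
structure IsC11 (f : Plane → ℝ) (U V L : ℝ) : Prop where
  bound : ∀ x, |f x| ≤ U
  lip : ∀ x y, |f x - f y| ≤ V * ‖x - y‖
  second : ∀ a b : ℝ, 0 ≤ a → 0 ≤ b → a + b = 1 → ∀ z w : Plane,
    |a * f (z + b • w) + b * f (z - a • w) - f z| ≤ a * b * (L / 2) * ‖w‖ ^ 2

theorem continuous_of_lip {f : Plane → ℝ} {V : ℝ} (h : ∀ x y, |f x - f y| ≤ V * ‖x - y‖) :
    Continuous f := by
  refine (LipschitzWith.of_dist_le_mul (K := V.toNNReal) fun x y => ?_).continuous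
  rw [Real.dist_eq, dist_eq_norm]
  exact (h x y).trans (mul_le_mul_of_nonneg_right (Real.le_coe_toNNReal V) (norm_nonneg _))

theorem plane_exists_norm_one : ∃ v : Plane, ‖v‖ = 1 :=
  ⟨EuclideanSpace.single 0 1, by simp⟩

theorem IsC11.nonneg {f : Plane → ℝ} {U V L : ℝ} (h : IsC11 f U V L) :
    0 ≤ U ∧ 0 ≤ V ∧ 0 ≤ L := by
  obtain ⟨v, hv⟩ := plane_exists_norm_one
  refine ⟨(abs_nonneg _).trans (h.bound 0), ?_, ?_⟩
  · simpa [hv] using (abs_nonneg _).trans (h.lip v 0)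
  · have := (abs_nonneg _).trans (h.second (1 / 2) (1 / 2) (by norm_num) (by norm_num)
      (by norm_num) 0 v)
    rw [hv] at this
    linarith

theorem IsC11.comp_actO2 {f : Plane → ℝ} {U V L : ℝ} (h : IsC11 f U V L) (A : O2) (b : Plane) :
    IsC11 (fun x => f (actO2 A (x - b))) U V L where
  bound x := h.bound _
  lip x y := by
    refine (h.lip _ _).trans_eq ?_
    rw [← actO2_sub, norm_actO2, sub_sub_sub_cancel_right]
  second s t hs ht hst z w := by
    have := h.second s t hs ht hst (actO2 A (z - b)) (actO2 A w)
    rw [norm_actO2, ← actO2_smul, ← actO2_smul, ← actO2_add, ← actO2_sub] at this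
    rwa [add_sub_right_comm z, sub_right_comm z]

theorem abs_taylor_le {f : Plane → ℝ} {F G D : ℝ} (hf : BoundedC2 f F G D) (x v : Plane) :
    |f (x + v) - f x - fderiv ℝ f x v| ≤ D / 2 * ‖v‖ ^ 2 := by
  have hd : Differentiable ℝ f := hf.1.differentiable (by norm_num)
  have hd2 : Differentiable ℝ (fderiv ℝ f) :=
    (hf.1.fderiv_right (m := 1) (by norm_num)).differentiable (by norm_num)
  have hder (s : ℝ) : HasDerivAt (fun s : ℝ => f (x + s • v) - f x - s * fderiv ℝ f x v)
      (fderiv ℝ f (x + s • v) v - fderiv ℝ f x v) s := by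
    have h1 : HasDerivAt (fun s : ℝ => x + s • v) v s := by
      simpa using ((hasDerivAt_id s).smul_const v).const_add x
    have h2 := (hd (x + s • v)).hasFDerivAt.comp_hasDerivAt s h1
    have h3 : HasDerivAt (fun s : ℝ => s * fderiv ℝ f x v) (fderiv ℝ f x v) s := by
      simpa using (hasDerivAt_id s).mul_const (fderiv ℝ f x v)
    exact (h2.sub_const (f x)).sub h3
  have key := image_norm_le_of_norm_deriv_right_le_deriv_boundary (a := 0) (b := 1)
    (f := fun s : ℝ => f (x + s • v) - f x - s * fderiv ℝ f x v)
    (f' := fun s => fderiv ℝ f (x + s • v) v - fderiv ℝ f x v)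
    (fun s _ => (hder s).continuousAt.continuousWithinAt)
    (fun s _ => (hder s).hasDerivWithinAt)
    (B := fun s => D / 2 * ‖v‖ ^ 2 * s ^ 2) (B' := fun s => D * ‖v‖ ^ 2 * s)
    (by simp)
    (fun s => by
      refine ((hasDerivAt_pow 2 s).const_mul (D / 2 * ‖v‖ ^ 2)).congr_deriv ?_
      push_cast
      ring)
    (fun s hs => by
      rw [← sub_apply]
      refine (ContinuousLinearMap.le_opNorm _ _).trans ?_
      have h4 := convex_univ.norm_image_sub_le_of_norm_fderiv_le (𝕜 := ℝ) (f := fderiv ℝ f)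
        (fun y _ => hd2 y) (fun y _ => (hf.2 y).2.2) (Set.mem_univ x)
        (Set.mem_univ (x + s • v))
      rw [add_sub_cancel_left, norm_smul, Real.norm_of_nonneg hs.1] at h4
      calc _ ≤ D * (s * ‖v‖) * ‖v‖ := mul_le_mul_of_nonneg_right h4 (norm_nonneg _)
        _ = _ := by ring)
    (Set.right_mem_Icc.2 zero_le_one)
  simpa using key

theorem BoundedC2.isC11 {f : Plane → ℝ} {F G D : ℝ} (hf : BoundedC2 f F G D) :
    IsC11 f F G D where
  bound x := (hf.2 x).1
  lip x y := by
    have hd : Differentiable ℝ f := hf.1.differentiable (by norm_num)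
    exact convex_univ.norm_image_sub_le_of_norm_fderiv_le (𝕜 := ℝ)
      (fun y _ => hd y) (fun y _ => (hf.2 y).2.1) (Set.mem_univ y) (Set.mem_univ x)
  second a b ha hb hab z w := by
    have h1 := abs_le.1 (abs_taylor_le hf z (b • w))
    have h2 := abs_le.1 (abs_taylor_le hf z (-(a • w)))
    rw [← sub_eq_add_neg] at h2
    simp only [map_neg, map_smul, norm_neg, norm_smul, Real.norm_of_nonneg ha,
      Real.norm_of_nonneg hb, smul_eq_mul, mul_pow] at h1 h2
    -- The gradient terms cancel in the weighted sum, and the Taylor remainders add up because `a b²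
    -- + b a² = a b` when `a + b = 1`.
    have e1 : a * b * (D / 2) * ‖w‖ ^ 2
        = a * (D / 2 * (b ^ 2 * ‖w‖ ^ 2)) + b * (D / 2 * (a ^ 2 * ‖w‖ ^ 2)) := by
      linear_combination (-(a * b * (D / 2) * ‖w‖ ^ 2)) * hab
    have e2 : a * f (z + b • w) + b * f (z - a • w) - f z
        = a * (f (z + b • w) - f z - b * fderiv ℝ f z w)
          + b * (f (z - a • w) - f z - -(a * fderiv ℝ f z w)) := by
      linear_combination f z * hab
    rw [e1, e2, abs_le]
    constructor
    · nlinarith [mul_le_mul_of_nonneg_left h1.1 ha, mul_le_mul_of_nonneg_left h2.1 hb]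
    · nlinarith [mul_le_mul_of_nonneg_left h1.2 ha, mul_le_mul_of_nonneg_left h2.2 hb]

/-- A function with bounded Hessian that vanishes outside the ball of radius `R` is at most
`D R² / 4`. -/
theorem BoundedC2.abs_le_of_support {f : Plane → ℝ} {F G D R : ℝ} (hf : BoundedC2 f F G D)
    (hR : 0 < R) (hs : ∀ x, R ≤ ‖x‖ → f x = 0) (x : Plane) : |f x| ≤ D * R ^ 2 / 4 := by
  have hc : Continuous f := hf.1.continuous
  obtain ⟨x₀, hx₀, hmax⟩ := (isCompact_closedBall (0 : Plane) R).exists_isMaxOn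
    ⟨0, by simp [hR.le]⟩ (hc.abs.continuousOn)
  have hmax' : ∀ y, |f y| ≤ |f x₀| := fun y => by
    by_cases hy : ‖y‖ ≤ R
    · exact hmax (by simpa using hy)
    · rw [hs y (not_le.1 hy).le, abs_zero]; exact abs_nonneg _
  have hd0 : fderiv ℝ f x₀ = 0 := by
    apply IsLocalExtr.fderiv_eq_zero
    rcases le_total 0 (f x₀) with h | h
    · refine Or.inr (Filter.Eventually.of_forall fun y => ?_)
      have := hmax' y
      rw [abs_of_nonneg h] at this
      exact (le_abs_self _).trans this
    · refine Or.inl (Filter.Eventually.of_forall fun y => ?_)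
      have := hmax' y
      rw [abs_of_nonpos h] at this
      linarith [neg_abs_le (f y)]
  have hx₀R : ‖x₀‖ ≤ R := by simpa using hx₀
  obtain ⟨u, hu, hxu⟩ : ∃ u : Plane, ‖u‖ = 1 ∧ x₀ = ‖x₀‖ • u := by
    by_cases h0 : x₀ = 0
    · obtain ⟨v, hv⟩ := plane_exists_norm_one
      exact ⟨v, hv, by simp [h0]⟩
    · refine ⟨‖x₀‖⁻¹ • x₀, ?_, ?_⟩
      · rw [norm_smul, norm_inv, norm_norm, inv_mul_cancel₀ (norm_ne_zero_iff.2 h0)]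
      · rw [smul_smul, mul_inv_cancel₀ (norm_ne_zero_iff.2 h0), one_smul]
  have hD : 0 ≤ D := hf.isC11.nonneg.2.2
  -- Taking `ρ` strictly larger than `R` makes `f` vanish near `ρ • u`, so its gradient vanishes
  -- there as well as at the maximum point `x₀`. Taylor expansions from these two points meet at the
  -- midpoint, each contributing `D d² / 2`; finally `ρ` decreases to `R`.
  have key : ∀ ρ, R < ρ → |f x₀| ≤ D * ρ ^ 2 / 4 := fun ρ hρ => by
    have hz : f (ρ • u) = 0 := hs _ (by
      rw [norm_smul, hu, Real.norm_of_nonneg (hR.le.trans hρ.le)]; linarith)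
    have hdz : fderiv ℝ f (ρ • u) = 0 := by
      have : f =ᶠ[nhds (ρ • u)] fun _ => (0 : ℝ) := by
        have ho : IsOpen {y : Plane | R < ‖y‖} := isOpen_lt continuous_const continuous_norm
        filter_upwards [ho.mem_nhds (show R < ‖ρ • u‖ by
          rw [norm_smul, hu, Real.norm_of_nonneg (hR.le.trans hρ.le)]; linarith)] with y hy
        exact hs y (le_of_lt hy)
      rw [this.fderiv_eq]
      simp
    set d := (ρ - ‖x₀‖) / 2 with hd
    have h1 := abs_taylor_le hf x₀ (d • u)
    have h2 := abs_taylor_le hf (ρ • u) (-(d • u))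
    have e : x₀ + d • u = ρ • u + -(d • u) := by
      rw [hxu, ← add_smul, ← neg_smul, ← add_smul]
      congr 1
      rw [hd]; ring
    rw [hd0] at h1
    rw [hdz, hz, ← e] at h2
    rw [norm_neg] at h2
    simp only [norm_smul, hu, Real.norm_eq_abs, mul_one, sq_abs, zero_apply,
      sub_zero] at h1 h2
    have h3 : |f x₀| ≤ D * d ^ 2 := by
      have := abs_sub_abs_le_abs_sub (f x₀) (f (x₀ + d • u))
      rw [abs_sub_comm] at this
      linarith
    have h4 : d ^ 2 ≤ ρ ^ 2 / 4 := by
      have : (ρ - ‖x₀‖) ^ 2 ≤ ρ ^ 2 :=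
        pow_le_pow_left₀ (by linarith) (by linarith [norm_nonneg x₀]) 2
      rw [hd]; nlinarith
    nlinarith [mul_le_mul_of_nonneg_left h4 hD]
  have hlim : Filter.Tendsto (fun ρ : ℝ => D * ρ ^ 2 / 4) (nhdsWithin R (Set.Ioi R))
      (nhds (D * R ^ 2 / 4)) :=
    (Continuous.tendsto (by fun_prop) R).mono_left nhdsWithin_le_nhds
  exact (hmax' x).trans (ge_of_tendsto hlim (by
    filter_upwards [self_mem_nhdsWithin] with ρ hρ using key ρ hρ))

/-! ### Semiconvexity and second differences -/

/-- Semiconvexity with modulus `L` on segments of length at most `ρ`. -/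
def IsSemiconvex (f : Plane → ℝ) (ρ L : ℝ) : Prop :=
  ∀ a b : ℝ, 0 ≤ a → 0 ≤ b → a + b = 1 → ∀ z w : Plane, ‖w‖ ≤ ρ →
    f z ≤ a * f (z + b • w) + b * f (z - a • w) + a * b * (L / 2) * ‖w‖ ^ 2

theorem IsC11.isSemiconvex {f : Plane → ℝ} {U V L : ℝ} (h : IsC11 f U V L) (ρ : ℝ) :
    IsSemiconvex f ρ L := fun a b ha hb hab z w _ => by
  have := (abs_le.1 (h.second a b ha hb hab z w)).1
  linarith

/-- A maximum of two semiconvex functions is semiconvex, and the constant `0` is one. The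
corresponding upper bound on second differences would be lost at the kink. -/
theorem IsSemiconvex.relu {f : Plane → ℝ} {ρ L : ℝ} (hL : 0 ≤ L) (h : IsSemiconvex f ρ L) :
    IsSemiconvex (fun x => relu (f x)) ρ L := fun a b ha hb hab z w hw => by
  have h1 : a * f (z + b • w) ≤ a * _root_.relu (f (z + b • w)) :=
    mul_le_mul_of_nonneg_left (le_max_left _ _) ha
  have h2 : b * f (z - a • w) ≤ b * _root_.relu (f (z - a • w)) :=
    mul_le_mul_of_nonneg_left (le_max_left _ _) hb
  have h3 : 0 ≤ a * _root_.relu (f (z + b • w)) := mul_nonneg ha (le_max_right _ _)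
  have h4 : 0 ≤ b * _root_.relu (f (z - a • w)) := mul_nonneg hb (le_max_right _ _)
  have h5 : 0 ≤ a * b * (L / 2) * ‖w‖ ^ 2 := by positivity
  exact max_le ((h a b ha hb hab z w hw).trans (by linarith)) (by linarith)

theorem IsSemiconvex.reflect {f : Plane → ℝ} {ρ L : ℝ} (h : IsSemiconvex f ρ L) (x : Plane) :
    IsSemiconvex (fun c => f (x - c)) ρ L := fun a b ha hb hab z w hw => by
  have := h b a hb ha (by linarith) (x - z) w hw
  beta_reduce
  rw [show x - (z + b • w) = x - z - b • w by abel,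
    show x - (z - a • w) = x - z + a • w by abel]
  linarith

section SecondDifference

variable {v : Plane → ℝ} {ρ L : ℝ}

theorem IsSemiconvex.midpoint (hv : IsSemiconvex v ρ L) (c y : Plane) (hy : 2 * ‖y‖ ≤ ρ) :
    2 * v c ≤ v (c + y) + v (c - y) + L * ‖y‖ ^ 2 := by
  have := hv (1 / 2) (1 / 2) (by norm_num) (by norm_num) (by norm_num) c ((2 : ℝ) • y) (by
    rw [norm_smul]; simpa using hy)
  rw [smul_smul, norm_smul] at this
  norm_num at this
  nlinarith

/-- A direct application would need a segment of length `2 ‖E‖`. With `e = E / 2`, the second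
difference with step `E` at `c` is the sum, with weights 1, 2, 1, of those with step `e` at `c - e`,
`c`, `c + e`, which only use segments of length `‖E‖`. -/
theorem IsSemiconvex.secondDiff_ge (hv : IsSemiconvex v ρ L) (c E : Plane) (hE : ‖E‖ ≤ ρ) :
    -(L * ‖E‖ ^ 2) ≤ v (c + E) + v (c - E) - 2 * v c := by
  set e : Plane := (1 / 2 : ℝ) • E with he
  have hn : ‖e‖ = ‖E‖ / 2 := by rw [he, norm_smul]; norm_num; ring
  have hee : E = e + e := by rw [he, ← add_smul]; norm_num
  have h1 := hv.midpoint (c - e) e (by rw [hn]; linarith)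
  have h2 := hv.midpoint c e (by rw [hn]; linarith)
  have h3 := hv.midpoint (c + e) e (by rw [hn]; linarith)
  rw [hn, show c - e - e = c - E by rw [hee]; abel, sub_add_cancel] at h1
  rw [hn] at h2
  rw [hn, show c + e + e = c + E by rw [hee]; abel, add_sub_cancel_right] at h3
  nlinarith

/-- Each point `c ± μ • E` lies on the segment from `c` to `c ± E`, with weights `1 - μ` and `μ`. -/
theorem IsSemiconvex.secondDiff_smul_le (hv : IsSemiconvex v ρ L) (c E : Plane) (hE : ‖E‖ ≤ ρ)
    {μ : ℝ} (h0 : 0 ≤ μ) (h1 : μ ≤ 1) :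
    v (c + μ • E) + v (c - μ • E) - 2 * v c
      ≤ μ * (v (c + E) + v (c - E) - 2 * v c) + L * (μ * (1 - μ)) * ‖E‖ ^ 2 := by
  have k1 := hv μ (1 - μ) h0 (by linarith) (by ring) (c + μ • E) E hE
  have k2 := hv μ (1 - μ) h0 (by linarith) (by ring) (c - μ • E) (-E) (by rwa [norm_neg])
  rw [show c + μ • E + (1 - μ) • E = c + E by module, show c + μ • E - μ • E = c by module] at k1
  rw [show c - μ • E + (1 - μ) • -E = c - E by module,
    show c - μ • E - μ • -E = c by module, norm_neg] at k2
  linarith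

theorem IsSemiconvex.secondDiff_smul_le' (hv : IsSemiconvex v ρ L) (c E : Plane) (hE : ‖E‖ ≤ ρ)
    {μ : ℝ} (hμ : |μ| ≤ 1) :
    v (c + μ • E) + v (c - μ • E) - 2 * v c
      ≤ (v (c + E) + v (c - E) - 2 * v c) + L * (1 - μ ^ 2) * ‖E‖ ^ 2 := by
  have hΔ := hv.secondDiff_ge c E hE
  have key : v (c + |μ| • E) + v (c - |μ| • E) - 2 * v c
      ≤ (v (c + E) + v (c - E) - 2 * v c) + L * (1 - |μ| ^ 2) * ‖E‖ ^ 2 := by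
    have := hv.secondDiff_smul_le c E hE (abs_nonneg μ) hμ
    nlinarith [mul_nonneg (sub_nonneg.2 hμ) (sub_nonneg.2 hΔ)]
  rcases abs_choice μ with h | h
  · rwa [h] at key
  · rw [h, neg_smul, ← sub_eq_add_neg, sub_neg_eq_add, neg_sq] at key
    linarith

/-- On a cell spanned by the orthogonal vectors `E`, `E'`, the second difference of a semiconvex
function is controlled by those along the two axes. -/
theorem IsSemiconvex.abs_secondDiff_le {h : ℝ} (hh : 0 < h) (hL : 0 ≤ L)
    (hv : IsSemiconvex v (3 * h / 2) L) (c E E' : Plane) (hE : ‖E‖ = h) (hE' : ‖E'‖ = h)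
    (hn : ∀ s t : ℝ, ‖s • E + t • E'‖ ^ 2 = (s ^ 2 + t ^ 2) * h ^ 2)
    {μ ν : ℝ} (hμ : |μ| ≤ 1) (hν : |ν| ≤ 1) {y : Plane}
    (hy : y = (μ / 2) • E + (ν / 2) • E') :
    |(v (c + y) + v (c - y)) / 2 - v c|
      ≤ ((v (c + E) + v (c - E) - 2 * v c) + (v (c + E') + v (c - E') - 2 * v c)) / 4
        + 3 / 4 * L * h ^ 2 := by
  have hμ2 : μ ^ 2 ≤ 1 := (sq_le_one_iff_abs_le_one μ).2 hμ
  have hν2 : ν ^ 2 ≤ 1 := (sq_le_one_iff_abs_le_one ν).2 hν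
  have hsmall (s t : ℝ) (hs : s ^ 2 ≤ 1) (ht : t ^ 2 ≤ 1) : ‖s • E + t • E'‖ ≤ 3 * h / 2 := by
    refine (sq_le_sq₀ (norm_nonneg _) (by positivity)).1 ?_
    rw [hn]
    nlinarith [sq_nonneg h]
  have hE1 : ‖E‖ ≤ 3 * h / 2 := by linarith
  have hE1' : ‖E'‖ ≤ 3 * h / 2 := by linarith
  have a1 := hv.secondDiff_ge c E hE1
  have a2 := hv.secondDiff_ge c E' hE1'
  have b1 := hv.secondDiff_smul_le' c E hE1 hμ
  have b2 := hv.secondDiff_smul_le' c E' hE1' hν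
  have m := hv.midpoint c y (by
    have : ‖(2 : ℝ) • y‖ ≤ 3 * h / 2 := by
      rw [show (2 : ℝ) • y = μ • E + ν • E' by rw [hy]; module]
      exact hsmall μ ν hμ2 hν2
    rwa [norm_smul, Real.norm_two] at this)
  have hy2 : ‖y‖ ^ 2 = ((μ / 2) ^ 2 + (ν / 2) ^ 2) * h ^ 2 := by rw [hy, hn]
  -- The point `c + y` is the midpoint of `c + μ • E` and `c + ν • E'`, and `c - y` that of their
  -- reflections in `c`. This reduces an off-axis second difference to axial ones. The segments have
  -- length at most `√2 h`, which is why radius `3h/2` suffices.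
  have c1 := hv (1 / 2) (1 / 2) (by norm_num) (by norm_num) (by norm_num) (c + y)
    (μ • E + (-ν) • E') (hsmall μ (-ν) hμ2 (by rwa [neg_sq]))
  have c2 := hv (1 / 2) (1 / 2) (by norm_num) (by norm_num) (by norm_num) (c - y)
    (μ • E + (-ν) • E') (hsmall μ (-ν) hμ2 (by rwa [neg_sq]))
  rw [hn, show c + y + (1 / 2 : ℝ) • (μ • E + (-ν) • E') = c + μ • E by rw [hy]; module,
    show c + y - (1 / 2 : ℝ) • (μ • E + (-ν) • E') = c + ν • E' by rw [hy]; module] at c1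
  rw [hn, show c - y + (1 / 2 : ℝ) • (μ • E + (-ν) • E') = c - ν • E' by rw [hy]; module,
    show c - y - (1 / 2 : ℝ) • (μ • E + (-ν) • E') = c - μ • E by rw [hy]; module] at c2
  rw [hE] at a1 b1
  rw [hE'] at a2 b2
  rw [hy2] at m
  have q : 0 ≤ L * h ^ 2 := by positivity
  have qμ : L * h ^ 2 * μ ^ 2 ≤ L * h ^ 2 := mul_le_of_le_one_right q hμ2
  have qν : L * h ^ 2 * ν ^ 2 ≤ L * h ^ 2 := mul_le_of_le_one_right q hν2
  have qμ0 : 0 ≤ L * h ^ 2 * μ ^ 2 := by positivity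
  have qν0 : 0 ≤ L * h ^ 2 * ν ^ 2 := by positivity
  rw [abs_le]
  constructor <;> linarith

end SecondDifference

/-! ### The padded lattice and summation by parts -/

/-- The points of the lattice that contains the centred `p × p` grid, which is the part with
`1 ≤ i, j ≤ p`. -/
noncomputable def latticePoint (p : ℕ) (h : ℝ) (i j : ℕ) : Plane :=
  !₂[((i : ℝ) - ((p : ℝ) + 1) / 2) * h, ((j : ℝ) - ((p : ℝ) + 1) / 2) * h]

theorem gridPoint_eq_latticePoint (p : ℕ) (h : ℝ) (k l : Fin p) :
    gridPoint p p h k l = latticePoint p h (k + 1) (l + 1) := by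
  simp [gridPoint, latticePoint]

/-- The vector of length `|h|` along the `m`-th axis. -/
noncomputable def axis (h : ℝ) (m : Fin 2) : Plane := EuclideanSpace.single m h

theorem norm_axis {h : ℝ} (hh : 0 < h) (m : Fin 2) : ‖axis h m‖ = h := by
  simp [axis, abs_of_pos hh]

theorem norm_sq_plane (x : Plane) : ‖x‖ ^ 2 = x 0 ^ 2 + x 1 ^ 2 := by
  rw [EuclideanSpace.norm_sq_eq]
  simp [Fin.sum_univ_two]

theorem latticePoint_succ_left (p : ℕ) (h : ℝ) (i j : ℕ) :
    latticePoint p h (i + 1) j = latticePoint p h i j + axis h 0 := by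
  ext m
  fin_cases m <;> simp [latticePoint, axis]
  ring

theorem latticePoint_succ_right (p : ℕ) (h : ℝ) (i j : ℕ) :
    latticePoint p h i (j + 1) = latticePoint p h i j + axis h 1 := by
  ext m
  fin_cases m <;> simp [latticePoint, axis]
  ring

theorem abs_coord_le_norm (x : Plane) (m : Fin 2) : |x m| ≤ ‖x‖ := by
  simpa using EuclideanSpace.norm_eq x ▸ Real.abs_le_sqrt (x := x m) (y := ∑ i, ‖x i‖ ^ 2) (by
    fin_cases m <;> simp [Fin.sum_univ_two] <;> positivity)

theorem sum_range_pad {a : ℕ → ℝ} {p : ℕ} (h0 : a 0 = 0) (h1 : a (p + 1) = 0) :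
    ∑ i ∈ Finset.range (p + 2), a i = ∑ i ∈ Finset.range p, a (i + 1) := by
  rw [Finset.sum_range_succ, h1, Finset.sum_range_succ', h0, add_zero, add_zero]

theorem sum_mul_secondDiff (a v : ℕ → ℝ) (p : ℕ) :
    ∑ i ∈ Finset.range p, a (i + 1) * (v (i + 2) + v i - 2 * v (i + 1))
      = a (p + 1) * (v (p + 1) - v p) - a 0 * (v 1 - v 0)
        - ∑ i ∈ Finset.range (p + 1), (a (i + 1) - a i) * (v (i + 1) - v i) := by
  induction p with
  | zero => simp; ring
  | succ p ih =>
    rw [Finset.sum_range_succ, ih, Finset.sum_range_succ _ (p + 1)]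
    ring

/-- Abel summation leaves only products of first differences, since the weight vanishes at both
ends. So the signed sum is bounded above by Lipschitz constants alone. -/
theorem sum_mul_secondDiff_le {a v : ℕ → ℝ} {p : ℕ} {g u : ℝ} (h0 : a 0 = 0)
    (h1 : a (p + 1) = 0) (ha : ∀ i, |a (i + 1) - a i| ≤ g) (hv : ∀ i, |v (i + 1) - v i| ≤ u) :
    ∑ i ∈ Finset.range p, a (i + 1) * (v (i + 2) + v i - 2 * v (i + 1))
      ≤ (p + 1) * (g * u) := by
  have hg : 0 ≤ g := (abs_nonneg _).trans (ha 0)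
  rw [sum_mul_secondDiff, h0, h1]
  have : ∑ i ∈ Finset.range (p + 1), -((a (i + 1) - a i) * (v (i + 1) - v i))
      ≤ ∑ i ∈ Finset.range (p + 1), g * u :=
    Finset.sum_le_sum fun i _ => (neg_le_abs _).trans (by
      rw [abs_mul]; exact mul_le_mul (ha i) (hv i) (abs_nonneg _) hg)
  rw [Finset.sum_neg_distrib, Finset.sum_const, Finset.card_range, nsmul_eq_mul] at this
  push_cast at this
  linarith

/-! ### Kernels, features and the error at the quadrature nodes -/

/-- A kernel on the plane supported in the disc of radius `(p + 1) h / 2`. -/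
structure IsKernel (p : ℕ) (h : ℝ) (φ : Plane → ℝ) (F G D : ℝ) : Prop where
  isC11 : IsC11 φ F G D
  support : ∀ x, ((p : ℝ) + 1) * h / 2 ≤ ‖x‖ → φ x = 0

theorem FilterBound.isKernel {p : ℕ} {h : ℝ} {φ : Plane → ℝ} {F G D : ℝ}
    (hφ : FilterBound p h φ F G D) : IsKernel p h φ F G D :=
  ⟨hφ.1.isC11, hφ.2⟩

theorem IsKernel.comp_actO2 {p : ℕ} {h : ℝ} {φ : Plane → ℝ} {F G D : ℝ}
    (hφ : IsKernel p h φ F G D) (A : O2) : IsKernel p h (fun x => φ (actO2 A x)) F G D where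
  isC11 := by simpa using hφ.isC11.comp_actO2 A 0
  support x hx := hφ.support _ (by rwa [norm_actO2])

/-- The ring added around the `p × p` grid has a coordinate equal to `±(p + 1) h / 2`, so it avoids
the open disc of support. Padding the grid therefore changes no sum and supplies the zero boundary
values for Abel summation. -/
theorem IsKernel.latticePoint_eq_zero {p : ℕ} {h : ℝ} (hh : 0 < h) {φ : Plane → ℝ} {F G D : ℝ}
    (hφ : IsKernel p h φ F G D) {i j : ℕ} (hij : i = 0 ∨ i = p + 1 ∨ j = 0 ∨ j = p + 1) :
    φ (latticePoint p h i j) = 0 := by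
  apply hφ.support
  have hR : 0 ≤ ((p : ℝ) + 1) * h / 2 := by positivity
  rcases hij with rfl | rfl | rfl | rfl
  · refine le_trans ?_ (abs_coord_le_norm _ 0)
    simp only [latticePoint]
    refine le_trans (le_of_eq ?_) (neg_le_abs _)
    simp
    ring
  · refine le_trans ?_ (abs_coord_le_norm _ 0)
    simp only [latticePoint]
    refine le_trans (le_of_eq ?_) (le_abs_self _)
    simp
    ring
  · refine le_trans ?_ (abs_coord_le_norm _ 1)
    simp only [latticePoint]
    refine le_trans (le_of_eq ?_) (neg_le_abs _)
    simp
    ring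
  · refine le_trans ?_ (abs_coord_le_norm _ 1)
    simp only [latticePoint]
    refine le_trans (le_of_eq ?_) (le_abs_self _)
    simp
    ring

/-- `|f| ≤ U`, the function `f` is `V`-Lipschitz, and it is `L`-semiconvex on short segments. -/
structure IsFeature (h : ℝ) (f : Plane → ℝ) (U V L : ℝ) : Prop where
  bound : ∀ x, |f x| ≤ U
  lip : ∀ x y, |f x - f y| ≤ V * ‖x - y‖
  semiconvex : IsSemiconvex f (3 * h / 2) L
  nonneg : 0 ≤ L

theorem IsC11.isFeature {f : Plane → ℝ} {U V L : ℝ} (hf : IsC11 f U V L) (h : ℝ) :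
    IsFeature h f U V L :=
  ⟨hf.bound, hf.lip, hf.isSemiconvex _, hf.nonneg.2.2⟩

theorem IsFeature.reflect {h : ℝ} {f : Plane → ℝ} {U V L : ℝ} (hf : IsFeature h f U V L)
    (x : Plane) : IsFeature h (fun c => f (x - c)) U V L where
  bound c := hf.bound _
  lip c d := (hf.lip _ _).trans_eq (by rw [sub_sub_sub_cancel_left, norm_sub_rev])
  semiconvex := hf.semiconvex.reflect x
  nonneg := hf.nonneg

section Quadrature

variable {p : ℕ} {h : ℝ} {φ v : Plane → ℝ} {F G D U V L : ℝ}

/-- Row by row, `|φ|` inherits the Lipschitz constant of `φ` and vanishes at both ends, so Abel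
summation applies. The weight must be `|φ|` rather than `φ` because the nodewise bounds are on
absolute values. -/
theorem IsKernel.sum_abs_mul_secondDiff_left (hφ : IsKernel p h φ F G D) (hh : 0 < h)
    (hv : ∀ x y, |v x - v y| ≤ V * ‖x - y‖) :
    ∑ i ∈ Finset.range (p + 2), ∑ j ∈ Finset.range (p + 2), |φ (latticePoint p h i j)| *
      (v (latticePoint p h i j + axis h 0) + v (latticePoint p h i j - axis h 0)
        - 2 * v (latticePoint p h i j)) ≤ p * ((p + 1) * (G * h * (V * h))) := by
  rw [Finset.sum_comm, sum_range_pad]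
  · have hrow : ∀ j ∈ Finset.range p, ∑ i ∈ Finset.range (p + 2),
        |φ (latticePoint p h i (j + 1))| *
        (v (latticePoint p h i (j + 1) + axis h 0) + v (latticePoint p h i (j + 1) - axis h 0)
        - 2 * v (latticePoint p h i (j + 1))) ≤ (p + 1) * (G * h * (V * h)) := fun j _ => by
      rw [sum_range_pad]
      · refine le_trans (le_of_eq ?_) (sum_mul_secondDiff_le
          (a := fun i => |φ (latticePoint p h i (j + 1))|)
          (v := fun i => v (latticePoint p h i (j + 1))) (p := p)
          (g := G * h) (u := V * h) ?_ ?_ ?_ ?_)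
        · refine Finset.sum_congr rfl fun i _ => ?_
          rw [latticePoint_succ_left p h (i + 1), latticePoint_succ_left p h i,
            add_sub_cancel_right]
        · simp [hφ.latticePoint_eq_zero hh]
        · simp [hφ.latticePoint_eq_zero hh]
        · intro i
          refine (abs_abs_sub_abs_le _ _).trans ((hφ.isC11.lip _ _).trans_eq ?_)
          rw [latticePoint_succ_left, add_sub_cancel_left, norm_axis hh]
        · intro i
          refine (hv _ _).trans_eq ?_
          rw [latticePoint_succ_left, add_sub_cancel_left, norm_axis hh]
      · simp [hφ.latticePoint_eq_zero hh]
      · simp [hφ.latticePoint_eq_zero hh]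
    simpa using Finset.sum_le_sum hrow
  · simp [hφ.latticePoint_eq_zero hh]
  · simp [hφ.latticePoint_eq_zero hh]

theorem IsKernel.sum_abs_mul_secondDiff_right (hφ : IsKernel p h φ F G D) (hh : 0 < h)
    (hv : ∀ x y, |v x - v y| ≤ V * ‖x - y‖) :
    ∑ i ∈ Finset.range (p + 2), ∑ j ∈ Finset.range (p + 2), |φ (latticePoint p h i j)| *
      (v (latticePoint p h i j + axis h 1) + v (latticePoint p h i j - axis h 1)
        - 2 * v (latticePoint p h i j)) ≤ p * ((p + 1) * (G * h * (V * h))) := by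
  rw [sum_range_pad]
  · have hrow : ∀ i ∈ Finset.range p, ∑ j ∈ Finset.range (p + 2),
        |φ (latticePoint p h (i + 1) j)| *
        (v (latticePoint p h (i + 1) j + axis h 1) + v (latticePoint p h (i + 1) j - axis h 1)
        - 2 * v (latticePoint p h (i + 1) j)) ≤ (p + 1) * (G * h * (V * h)) := fun i _ => by
      rw [sum_range_pad]
      · refine le_trans (le_of_eq ?_) (sum_mul_secondDiff_le
          (a := fun j => |φ (latticePoint p h (i + 1) j)|)
          (v := fun j => v (latticePoint p h (i + 1) j)) (p := p)
          (g := G * h) (u := V * h) ?_ ?_ ?_ ?_)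
        · refine Finset.sum_congr rfl fun j _ => ?_
          rw [latticePoint_succ_right p h (i + 1) (j + 1), latticePoint_succ_right p h (i + 1) j,
            add_sub_cancel_right]
        · simp [hφ.latticePoint_eq_zero hh]
        · simp [hφ.latticePoint_eq_zero hh]
        · intro j
          refine (abs_abs_sub_abs_le _ _).trans ((hφ.isC11.lip _ _).trans_eq ?_)
          rw [latticePoint_succ_right, add_sub_cancel_left, norm_axis hh]
        · intro j
          refine (hv _ _).trans_eq ?_
          rw [latticePoint_succ_right, add_sub_cancel_left, norm_axis hh]
      · simp [hφ.latticePoint_eq_zero hh]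
      · simp [hφ.latticePoint_eq_zero hh]
    simpa using Finset.sum_le_sum hrow
  · simp [hφ.latticePoint_eq_zero hh]
  · simp [hφ.latticePoint_eq_zero hh]

theorem IsKernel.sum_abs_le (hφ : IsKernel p h φ F G D) (hh : 0 < h) :
    ∑ i ∈ Finset.range (p + 2), ∑ j ∈ Finset.range (p + 2), |φ (latticePoint p h i j)|
      ≤ p ^ 2 * F := by
  rw [sum_range_pad]
  · have : ∀ i ∈ Finset.range p, ∑ j ∈ Finset.range (p + 2), |φ (latticePoint p h (i + 1) j)|
        ≤ p * F := fun i _ => by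
      rw [sum_range_pad]
      · simpa using Finset.sum_le_sum (s := Finset.range p)
          (f := fun j => |φ (latticePoint p h (i + 1) (j + 1))|)
          fun j _ => hφ.isC11.bound (latticePoint p h (i + 1) (j + 1))
      · simp [hφ.latticePoint_eq_zero hh]
      · simp [hφ.latticePoint_eq_zero hh]
    refine (Finset.sum_le_sum this).trans_eq ?_
    simp
    ring
  · simp [hφ.latticePoint_eq_zero hh]
  · simp [hφ.latticePoint_eq_zero hh]

theorem norm_axis_comb (h s t : ℝ) :
    ‖s • axis h 0 + t • axis h 1‖ ^ 2 = (s ^ 2 + t ^ 2) * h ^ 2 := by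
  rw [norm_sq_plane]
  simp [axis]
  ring

/-- The symmetrised error of one quadrature node, for the product of a kernel with a feature. -/
theorem IsKernel.abs_node_le (hφ : IsKernel p h φ F G D) (hh : 0 < h) (hv : IsFeature h v U V L)
    {y : Plane} (hy : ∀ m, |y m| ≤ h / 2) (c : Plane) :
    |(φ (c + y) * v (c + y) + φ (c - y) * v (c - y)) / 2 - φ c * v c|
      ≤ 1 / 4 * (|φ c| * (v (c + axis h 0) + v (c - axis h 0) - 2 * v c))
        + 1 / 4 * (|φ c| * (v (c + axis h 1) + v (c - axis h 1) - 2 * v c))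
        + 3 / 4 * L * h ^ 2 * |φ c| + (G * V * h ^ 2 / 2 + D * U * h ^ 2 / 4) := by
  obtain ⟨-, hG, hD⟩ := hφ.isC11.nonneg
  have hU : 0 ≤ U := (abs_nonneg _).trans (hv.bound 0)
  have hy2 : ‖y‖ ^ 2 ≤ h ^ 2 / 2 := by
    rw [norm_sq_plane]
    have h0 := sq_le_sq' (abs_le.1 (hy 0)).1 (abs_le.1 (hy 0)).2
    have h1 := sq_le_sq' (abs_le.1 (hy 1)).1 (abs_le.1 (hy 1)).2
    linarith
  have k1 := hv.semiconvex.abs_secondDiff_le hh hv.nonneg c (axis h 0) (axis h 1)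
    (norm_axis hh 0) (norm_axis hh 1) (norm_axis_comb h) (μ := 2 * y 0 / h) (ν := 2 * y 1 / h)
    (y := y)
    (by rw [abs_div, abs_mul, abs_of_pos hh, div_le_one hh, abs_two]; linarith [hy 0])
    (by rw [abs_div, abs_mul, abs_of_pos hh, div_le_one hh, abs_two]; linarith [hy 1])
    (by ext m; fin_cases m <;> simp [axis] <;> field_simp)
  have k2 := hφ.isC11.second (1 / 2) (1 / 2) (by norm_num) (by norm_num) (by norm_num) c
    ((2 : ℝ) • y)
  rw [smul_smul, norm_smul] at k2
  norm_num at k2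
  have k3 : |φ (c + y) - φ c| * |v (c + y) - v c| ≤ G * V * ‖y‖ ^ 2 := by
    have := mul_le_mul (hφ.isC11.lip (c + y) c) (hv.lip (c + y) c) (abs_nonneg _)
      (mul_nonneg hG (norm_nonneg _))
    rw [add_sub_cancel_left] at this
    exact this.trans_eq (by ring)
  have k4 : |φ (c - y) - φ c| * |v (c - y) - v c| ≤ G * V * ‖y‖ ^ 2 := by
    have := mul_le_mul (hφ.isC11.lip (c - y) c) (hv.lip (c - y) c) (abs_nonneg _)
      (mul_nonneg hG (norm_nonneg _))
    rw [sub_sub_cancel_left, norm_neg] at this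
    exact this.trans_eq (by ring)
  rw [← abs_mul] at k3 k4
  -- The discrete product rule for second differences: only the term in which `φ` is
  -- undifferentiated needs the semiconvexity of `v`.
  have e : (φ (c + y) * v (c + y) + φ (c - y) * v (c - y)) / 2 - φ c * v c
      = φ c * ((v (c + y) + v (c - y)) / 2 - v c)
        + v c * (1 / 2 * φ (c + y) + 1 / 2 * φ (c - y) - φ c)
        + ((φ (c + y) - φ c) * (v (c + y) - v c)
          + (φ (c - y) - φ c) * (v (c - y) - v c)) / 2 := by ring
  have hV : 0 ≤ V := by
    obtain ⟨w, hw⟩ := plane_exists_norm_one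
    simpa [hw] using (abs_nonneg _).trans (hv.lip w 0)
  have m1 : |φ c * ((v (c + y) + v (c - y)) / 2 - v c)| ≤ _ :=
    (abs_mul _ _).le.trans (mul_le_mul_of_nonneg_left k1 (abs_nonneg (φ c)))
  have m2 : |v c * (1 / 2 * φ (c + y) + 1 / 2 * φ (c - y) - φ c)|
      ≤ U * (D * h ^ 2 / 4) := by
    rw [abs_mul]
    refine mul_le_mul (hv.bound c) (k2.trans ?_) (abs_nonneg _) hU
    nlinarith
  have m3 : G * V * ‖y‖ ^ 2 ≤ G * V * (h ^ 2 / 2) :=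
    mul_le_mul_of_nonneg_left hy2 (mul_nonneg hG hV)
  rw [e]
  refine (abs_add_le _ _).trans ((add_le_add_left (abs_add_le _ _) _).trans ?_)
  rw [abs_div, abs_two]
  have m4 := abs_add_le ((φ (c + y) - φ c) * (v (c + y) - v c))
    ((φ (c - y) - φ c) * (v (c - y) - v c))
  linarith

/-- The symmetrised error of the quadrature on the grid, for a fixed point of the cell. -/
theorem IsKernel.abs_sum_node_le (hφ : IsKernel p h φ F G D) (hh : 0 < h)
    (hv : IsFeature h v U V L) {y : Plane} (hy : ∀ m, |y m| ≤ h / 2) :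
    |∑ i ∈ Finset.range (p + 2), ∑ j ∈ Finset.range (p + 2),
      ((φ (latticePoint p h i j + y) * v (latticePoint p h i j + y)
        + φ (latticePoint p h i j - y) * v (latticePoint p h i j - y)) / 2
        - φ (latticePoint p h i j) * v (latticePoint p h i j))|
      ≤ ((p + 2) ^ 2 * (G * V / 2 + D * U / 4) + p * (p + 1) / 2 * (G * V)
        + 3 / 4 * p ^ 2 * F * L) * h ^ 2 := by
  refine (Finset.abs_sum_le_sum_abs _ _).trans ((Finset.sum_le_sum fun i _ =>
    (Finset.abs_sum_le_sum_abs _ _).trans (Finset.sum_le_sum fun j _ =>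
      hφ.abs_node_le hh hv hy (latticePoint p h i j))).trans ?_)
  simp only [Finset.sum_add_distrib, ← Finset.mul_sum]
  have h1 := hφ.sum_abs_mul_secondDiff_left hh hv.lip
  have h2 := hφ.sum_abs_mul_secondDiff_right hh hv.lip
  have h3 := mul_le_mul_of_nonneg_left (hφ.sum_abs_le hh)
    (show 0 ≤ 3 / 4 * L * h ^ 2 by have := hv.nonneg; positivity)
  simp only [Finset.sum_const, Finset.card_range, nsmul_eq_mul]
  push_cast
  linarith

end Quadrature

/-! ### Tiling the support by cells and the midpoint rule -/

/-- The half-open square of side `h` around the origin. -/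
def cell (h : ℝ) : Set Plane := {y | ∀ m, y m ∈ Set.Ico (-(h / 2)) (h / 2)}

theorem cell_eq_preimage (h : ℝ) : cell h = (MeasurableEquiv.toLp 2 (Fin 2 → ℝ)).symm ⁻¹'
    Set.univ.pi fun _ => Set.Ico (-(h / 2)) (h / 2) := by
  ext y
  simp [cell]

theorem measurableSet_cell (h : ℝ) : MeasurableSet (cell h) := by
  rw [cell_eq_preimage]
  exact (MeasurableEquiv.measurable _) (MeasurableSet.univ_pi fun _ => measurableSet_Ico)

theorem volume_cell (h : ℝ) :
    MeasureTheory.volume (cell h) = ENNReal.ofReal h ^ 2 := by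
  rw [cell_eq_preimage,
    (EuclideanSpace.volume_preserving_symm_measurableEquiv_toLp (Fin 2)).measure_preimage
      (MeasurableSet.univ_pi fun _ => measurableSet_Ico).nullMeasurableSet,
    Real.volume_pi_Ico]
  simp

theorem sub_latticePoint_mem_cell_iff {p : ℕ} {h : ℝ} (hh : 0 < h) (x : Plane) (i j : ℕ)
    (hx : ∀ m, 0 ≤ x m / h + ((p : ℝ) + 2) / 2) :
    x - latticePoint p h i j ∈ cell h ↔
      ⌊x 0 / h + ((p : ℝ) + 2) / 2⌋₊ = i ∧ ⌊x 1 / h + ((p : ℝ) + 2) / 2⌋₊ = j := by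
  have key (s : ℝ) (i : ℕ) (hs : 0 ≤ s / h + ((p : ℝ) + 2) / 2) :
      ⌊s / h + ((p : ℝ) + 2) / 2⌋₊ = i ↔
        s - ((i : ℝ) - ((p : ℝ) + 1) / 2) * h ∈ Set.Ico (-(h / 2)) (h / 2) := by
    rw [Nat.floor_eq_iff hs, Set.mem_Ico]
    have e : s = s / h * h := by field_simp
    set q := s / h
    rw [e]
    constructor
    · rintro ⟨h1, h2⟩
      constructor <;> nlinarith
    · rintro ⟨h1, h2⟩
      constructor
      · by_contra hc
        nlinarith [mul_lt_mul_of_pos_right (not_le.1 hc) hh]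
      · by_contra hc
        nlinarith [mul_le_mul_of_nonneg_right (not_lt.1 hc) hh.le]
  rw [key _ i (hx 0), key _ j (hx 1)]
  simp [cell, latticePoint]

/-- With `p + 2` cells per side the tiled square has half-side `(p + 2) h / 2` and contains the disc
of support; the `p` cells at the grid points alone would not cover it. Half-open cells make the
cover exact. -/
theorem sum_indicator_cell {p : ℕ} {h : ℝ} (hh : 0 < h) (x : Plane)
    (hx : ‖x‖ < ((p : ℝ) + 1) * h / 2) :
    ∑ i ∈ Finset.range (p + 2), ∑ j ∈ Finset.range (p + 2),
      (cell h).indicator (fun _ => (1 : ℝ)) (x - latticePoint p h i j) = 1 := by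
  have hb (m : Fin 2) : |x m / h| < ((p : ℝ) + 1) / 2 := by
    rw [abs_div, abs_of_pos hh, div_lt_iff₀ hh]
    linarith [abs_coord_le_norm x m]
  have hpos (m : Fin 2) : 0 ≤ x m / h + ((p : ℝ) + 2) / 2 := by
    have := (abs_lt.1 (hb m)).1
    linarith
  have hlt (m : Fin 2) : ⌊x m / h + ((p : ℝ) + 2) / 2⌋₊ < p + 2 := by
    rw [Nat.floor_lt (hpos m)]
    have := (abs_lt.1 (hb m)).2
    push_cast
    linarith
  classical
  simp only [Set.indicator_apply, sub_latticePoint_mem_cell_iff hh x _ _ hpos, ite_and]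
  rw [Finset.sum_eq_single ⌊x 0 / h + ((p : ℝ) + 2) / 2⌋₊]
  · simp [hlt]
  · intro i _ hi
    simp [hi.symm]
  · intro hn
    exact absurd (Finset.mem_range.2 (hlt 0)) hn

open MeasureTheory in
theorem integral_eq_sum_cell {p : ℕ} {h : ℝ} (hh : 0 < h) {f : Plane → ℝ} (hf : Integrable f)
    (hs : ∀ x, ((p : ℝ) + 1) * h / 2 ≤ ‖x‖ → f x = 0) :
    ∫ x, f x = ∑ i ∈ Finset.range (p + 2), ∑ j ∈ Finset.range (p + 2),
      ∫ y in cell h, f (latticePoint p h i j + y) := by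
  have hint (c : Plane) : Integrable fun x => (cell h).indicator (fun _ => (1 : ℝ)) (x - c) * f x := by
    refine (hf.indicator ((measurable_sub_const c) (measurableSet_cell h))).congr ?_
    filter_upwards with x
    by_cases hx : x - c ∈ cell h <;> simp [Set.indicator, hx]
  calc ∫ x, f x = ∫ x, ∑ i ∈ Finset.range (p + 2), ∑ j ∈ Finset.range (p + 2),
        (cell h).indicator (fun _ => (1 : ℝ)) (x - latticePoint p h i j) * f x := by
        congr 1
        ext x
        simp only [← Finset.sum_mul]
        by_cases hx : ‖x‖ < ((p : ℝ) + 1) * h / 2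
        · rw [sum_indicator_cell hh x hx, one_mul]
        · rw [hs x (not_lt.1 hx), mul_zero]
    _ = ∑ i ∈ Finset.range (p + 2), ∑ j ∈ Finset.range (p + 2),
        ∫ x, (cell h).indicator (fun _ => (1 : ℝ)) (x - latticePoint p h i j) * f x := by
        rw [integral_finsetSum _ fun i _ => integrable_finsetSum _ fun j _ => hint _]
        exact Finset.sum_congr rfl fun i _ => integral_finsetSum _ fun j _ => hint _
    _ = _ := by
        refine Finset.sum_congr rfl fun i _ => Finset.sum_congr rfl fun j _ => ?_
        rw [← integral_add_left_eq_self _ (latticePoint p h i j),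
          ← integral_indicator (measurableSet_cell h)]
        congr 1
        ext y
        rw [add_sub_cancel_left]
        by_cases hy : y ∈ cell h <;> simp [hy]

theorem neg_latticePoint {p : ℕ} (h : ℝ) {i j : ℕ} (hi : i < p + 2) (hj : j < p + 2) :
    -latticePoint p h i j = latticePoint p h (p + 2 - 1 - i) (p + 2 - 1 - j) := by
  ext m
  have ei : ((p + 2 - 1 - i : ℕ) : ℝ) = p + 1 - i := by
    rw [Nat.cast_sub (by omega), Nat.cast_sub (by omega)]; push_cast; ring
  have ej : ((p + 2 - 1 - j : ℕ) : ℝ) = p + 1 - j := by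
    rw [Nat.cast_sub (by omega), Nat.cast_sub (by omega)]; push_cast; ring
  fin_cases m <;> simp only [latticePoint, ei, ej] <;> simp <;> ring

-- The half-open cell is not symmetric, so `f` is reflected instead of the cell; the padded lattice
-- is invariant under the reflection.
open MeasureTheory in
theorem integral_eq_sum_cell_sub {p : ℕ} {h : ℝ} (hh : 0 < h) {f : Plane → ℝ}
    (hf : Integrable f) (hs : ∀ x, ((p : ℝ) + 1) * h / 2 ≤ ‖x‖ → f x = 0) :
    ∫ x, f x = ∑ i ∈ Finset.range (p + 2), ∑ j ∈ Finset.range (p + 2),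
      ∫ y in cell h, f (latticePoint p h i j - y) := by
  rw [← integral_neg_eq_self, integral_eq_sum_cell hh hf.comp_neg
    fun x hx => hs _ (by rwa [norm_neg]), ← Finset.sum_range_reflect]
  refine Finset.sum_congr rfl fun i hi => ?_
  rw [← Finset.sum_range_reflect]
  refine Finset.sum_congr rfl fun j hj => ?_
  rw [Finset.mem_range] at hi hj
  congr 1
  ext y
  rw [neg_add, neg_latticePoint h (by omega) (by omega),
    show p + 2 - 1 - (p + 2 - 1 - i) = i by omega, show p + 2 - 1 - (p + 2 - 1 - j) = j by omega,
    ← sub_eq_add_neg]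

open MeasureTheory in
/-- A quadrature rule whose symmetrised nodewise error is at most `ε` has error at most `ε`. -/
theorem abs_integral_sub_sum_le {p : ℕ} {h : ℝ} (hh : 0 < h) {f : Plane → ℝ}
    (hf : Integrable f) (hs : ∀ x, ((p : ℝ) + 1) * h / 2 ≤ ‖x‖ → f x = 0) {ε : ℝ}
    (hε : ∀ y : Plane, (∀ m, |y m| ≤ h / 2) →
      |∑ i ∈ Finset.range (p + 2), ∑ j ∈ Finset.range (p + 2),
        ((f (latticePoint p h i j + y) + f (latticePoint p h i j - y)) / 2
          - f (latticePoint p h i j))| ≤ ε) :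
    |(h ^ 2)⁻¹ * (∫ x, f x) - ∑ i ∈ Finset.range (p + 2), ∑ j ∈ Finset.range (p + 2),
      f (latticePoint p h i j)| ≤ ε := by
  have hvol : volume (cell h) < ⊤ := by
    rw [volume_cell]; exact ENNReal.pow_lt_top ENNReal.ofReal_lt_top
  have hvol' : volume.real (cell h) = h ^ 2 := by
    rw [Measure.real, volume_cell, ENNReal.toReal_pow, ENNReal.toReal_ofReal hh.le]
  have i1 (c : Plane) : Integrable (fun y => f (c + y)) (volume.restrict (cell h)) :=
    (hf.comp_add_left c).integrableOn
  have i2 (c : Plane) : Integrable (fun y => f (c - y)) (volume.restrict (cell h)) :=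
    (hf.comp_sub_left c).integrableOn
  have i3 (c : Plane) : Integrable (fun _ => f c) (volume.restrict (cell h)) :=
    integrableOn_const hvol.ne
  have i4 (c : Plane) : Integrable (fun y => (f (c + y) + f (c - y)) / 2 - f c)
      (volume.restrict (cell h)) := (((i1 c).add (i2 c)).div_const 2).sub (i3 c)
  have i5 (c : Plane) : Integrable (fun y => (f (c + y) + f (c - y)) / 2)
      (volume.restrict (cell h)) := ((i1 c).add (i2 c)).div_const 2
  -- Averaging the two cell decompositions, with `c + y` and with `c - y`, removes the first-order
  -- terms at every node.
  have e : ∫ y in cell h, ∑ i ∈ Finset.range (p + 2), ∑ j ∈ Finset.range (p + 2),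
        ((f (latticePoint p h i j + y) + f (latticePoint p h i j - y)) / 2
          - f (latticePoint p h i j))
      = (∫ x, f x) - h ^ 2 * ∑ i ∈ Finset.range (p + 2), ∑ j ∈ Finset.range (p + 2),
          f (latticePoint p h i j) := by
    have e1 := integral_eq_sum_cell hh hf hs
    have e2 := integral_eq_sum_cell_sub hh hf hs
    rw [integral_finsetSum _ fun i _ => integrable_finsetSum _ fun j _ => i4 _]
    have : ∀ i ∈ Finset.range (p + 2), ∫ y in cell h, ∑ j ∈ Finset.range (p + 2),
        ((f (latticePoint p h i j + y) + f (latticePoint p h i j - y)) / 2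
          - f (latticePoint p h i j))
        = ∑ j ∈ Finset.range (p + 2), ((∫ y in cell h, f (latticePoint p h i j + y)) / 2
          + (∫ y in cell h, f (latticePoint p h i j - y)) / 2
          - h ^ 2 * f (latticePoint p h i j)) := fun i _ => by
      rw [integral_finsetSum _ fun j _ => i4 _]
      refine Finset.sum_congr rfl fun j _ => ?_
      rw [integral_sub (i5 _) (i3 _), integral_div,
        integral_add (i1 _) (i2 _), setIntegral_const, hvol', smul_eq_mul]
      ring
    rw [Finset.sum_congr rfl this]
    simp only [Finset.sum_sub_distrib, Finset.sum_add_distrib, ← Finset.mul_sum,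
      ← Finset.sum_div]
    rw [← e1, ← e2]
    ring
  have b := norm_setIntegral_le_of_norm_le_const (f := fun y =>
      ∑ i ∈ Finset.range (p + 2), ∑ j ∈ Finset.range (p + 2),
        ((f (latticePoint p h i j + y) + f (latticePoint p h i j - y)) / 2
          - f (latticePoint p h i j))) hvol (C := ε) fun y hy =>
    hε y fun m => abs_le.2 ⟨(hy m).1, (hy m).2.le⟩
  rw [e, hvol', Real.norm_eq_abs] at b
  have h2 : 0 < h ^ 2 := by positivity
  rw [← mul_le_mul_iff_of_pos_right h2]
  refine le_trans (le_of_eq ?_) b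
  rw [← abs_of_pos h2, ← abs_mul, abs_of_pos h2]
  congr 1
  field_simp

/-! ### Discrete and continuous convolution -/

/-- Convolution with a kernel by means of the values at the grid points. -/
noncomputable def discConv (p : ℕ) (h : ℝ) (φ u : Plane → ℝ) (x : Plane) : ℝ :=
  ∑ k : Fin p, ∑ l : Fin p, φ (gridPoint p p h k l) * u (x - gridPoint p p h k l)

/-- Convolution with a kernel, normalised by the area of a cell. -/
noncomputable def contConv (h : ℝ) (φ u : Plane → ℝ) (x : Plane) : ℝ :=
  (h ^ 2)⁻¹ * ∫ y, φ y * u (x - y)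

section Conv

variable {p : ℕ} {h : ℝ} {φ u : Plane → ℝ} {F G D U V L : ℝ}

theorem IsKernel.continuous (hφ : IsKernel p h φ F G D) : Continuous φ :=
  continuous_of_lip hφ.isC11.lip

theorem IsKernel.hasCompactSupport (hφ : IsKernel p h φ F G D) : HasCompactSupport φ :=
  HasCompactSupport.of_support_subset_isCompact
    (isCompact_closedBall (0 : Plane) (((p : ℝ) + 1) * h / 2)) fun x hx => by
      rw [mem_closedBall_zero_iff]
      by_contra hc
      exact hx (hφ.support x (not_le.1 hc).le)

theorem IsKernel.integrable_mul (hφ : IsKernel p h φ F G D) {w : Plane → ℝ}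
    (hw : Continuous w) : MeasureTheory.Integrable fun y => φ y * w y :=
  (hφ.continuous.mul hw).integrable_of_hasCompactSupport hφ.hasCompactSupport.mul_right

theorem IsKernel.discConv_eq (hφ : IsKernel p h φ F G D) (hh : 0 < h) (x : Plane) :
    discConv p h φ u x = ∑ i ∈ Finset.range (p + 2), ∑ j ∈ Finset.range (p + 2),
      φ (latticePoint p h i j) * u (x - latticePoint p h i j) := by
  rw [sum_range_pad]
  · rw [discConv, ← Fin.sum_univ_eq_sum_range (fun i => ∑ j ∈ Finset.range (p + 2),
      φ (latticePoint p h (i + 1) j) * u (x - latticePoint p h (i + 1) j))]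
    refine Finset.sum_congr rfl fun k _ => ?_
    rw [sum_range_pad]
    · rw [← Fin.sum_univ_eq_sum_range (fun j => φ (latticePoint p h (k + 1) (j + 1))
        * u (x - latticePoint p h (k + 1) (j + 1)))]
      simp only [gridPoint_eq_latticePoint]
    · simp [hφ.latticePoint_eq_zero hh]
    · simp [hφ.latticePoint_eq_zero hh]
  · simp [hφ.latticePoint_eq_zero hh]
  · simp [hφ.latticePoint_eq_zero hh]

theorem IsKernel.abs_contConv_sub_discConv_le (hφ : IsKernel p h φ F G D) (hh : 0 < h)
    (hu : IsFeature h u U V L) (x : Plane) :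
    |contConv h φ u x - discConv p h φ u x|
      ≤ ((p + 2) ^ 2 * (G * V / 2 + D * U / 4) + p * (p + 1) / 2 * (G * V)
        + 3 / 4 * p ^ 2 * F * L) * h ^ 2 := by
  rw [hφ.discConv_eq hh]
  have hc : Continuous fun y => u (x - y) :=
    (continuous_of_lip hu.lip).comp (continuous_const.sub continuous_id)
  exact abs_integral_sub_sum_le hh (hφ.integrable_mul hc)
    (fun y hy => by rw [hφ.support y hy, zero_mul])
    fun y hy => hφ.abs_sum_node_le hh (hu.reflect x) hy

end Conv

theorem abs_integral_le_of_support {f : Plane → ℝ} {ρ K : ℝ} (hρ : 0 ≤ ρ)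
    (hs : ∀ x, ρ ≤ ‖x‖ → f x = 0) (hK : ∀ x, ‖x‖ ≤ ρ → |f x| ≤ K) :
    |∫ x, f x| ≤ K * (Real.pi * ρ ^ 2) := by
  have hvol : MeasureTheory.volume.real (Metric.closedBall (0 : Plane) ρ) = Real.pi * ρ ^ 2 := by
    rw [MeasureTheory.Measure.real, EuclideanSpace.volume_closedBall_fin_two,
      ENNReal.toReal_mul, ENNReal.toReal_pow, ENNReal.toReal_ofReal hρ,
      ENNReal.toReal_ofReal Real.pi_pos.le, mul_comm]
  rw [← MeasureTheory.setIntegral_eq_integral_of_forall_compl_eq_zero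
    (s := Metric.closedBall (0 : Plane) ρ) fun x hx => hs x (by
      rw [mem_closedBall_zero_iff] at hx; exact (not_le.1 hx).le), ← hvol]
  exact MeasureTheory.norm_setIntegral_le_of_norm_le_const
    (MeasureTheory.measure_closedBall_lt_top) fun x hx =>
      (Real.norm_eq_abs _).trans_le (hK x (mem_closedBall_zero_iff.1 hx))

section Conv

variable {p : ℕ} {h : ℝ} {φ u : Plane → ℝ} {F G D U V L : ℝ}

theorem IsKernel.abs_integral_mul_le (hφ : IsKernel p h φ F G D) (hh : 0 < h) (hp : 8 ≤ p)
    {w : Plane → ℝ} {M : ℝ} (hM : ∀ y, ‖y‖ ≤ ((p : ℝ) + 1) * h / 2 → |w y| ≤ M) :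
    |(h ^ 2)⁻¹ * ∫ y, φ y * w y| ≤ p ^ 2 * F * M := by
  have hp' : (8 : ℝ) ≤ p := by exact_mod_cast hp
  have hF := hφ.isC11.nonneg.1
  have hM0 : 0 ≤ M := (abs_nonneg _).trans (hM 0 (by rw [norm_zero]; positivity))
  have key := abs_integral_le_of_support (f := fun y => φ y * w y) (K := F * M)
    (show 0 ≤ ((p : ℝ) + 1) * h / 2 by positivity)
    (fun x hx => by rw [hφ.support x hx, zero_mul])
    (fun x hx => by
      rw [abs_mul]; exact mul_le_mul (hφ.isC11.bound x) (hM x hx) (abs_nonneg _) hF)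
  -- The disc of support has area at most `p² h²`. This is what sets the threshold `p ≥ 8`: the
  -- inequality fails at `p = 7`.
  have hπ : Real.pi * (((p : ℝ) + 1) / 2) ^ 2 ≤ p ^ 2 := by
    nlinarith [Real.pi_lt_d2, sq_nonneg ((p : ℝ) + 1)]
  have h2 : 0 < h ^ 2 := by positivity
  rw [abs_mul, abs_of_pos (inv_pos.2 h2), inv_mul_le_iff₀ h2]
  refine key.trans ?_
  calc F * M * (Real.pi * (((p : ℝ) + 1) * h / 2) ^ 2)
      = h ^ 2 * (F * M) * (Real.pi * (((p : ℝ) + 1) / 2) ^ 2) := by ring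
    _ ≤ h ^ 2 * (F * M) * p ^ 2 := mul_le_mul_of_nonneg_left hπ (by positivity)
    _ = _ := by ring

theorem IsKernel.abs_integral_mul_sub_le (hφ : IsKernel p h φ F G D) (hh : 0 < h) (hp : 8 ≤ p)
    {w w' : Plane → ℝ} (hw : Continuous w) (hw' : Continuous w') {M : ℝ}
    (hM : ∀ y, ‖y‖ ≤ ((p : ℝ) + 1) * h / 2 → |w y - w' y| ≤ M) :
    |(h ^ 2)⁻¹ * (∫ y, φ y * w y) - (h ^ 2)⁻¹ * ∫ y, φ y * w' y| ≤ p ^ 2 * F * M := by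
  rw [← mul_sub, ← MeasureTheory.integral_sub (hφ.integrable_mul hw) (hφ.integrable_mul hw')]
  simp only [← mul_sub]
  exact hφ.abs_integral_mul_le hh hp hM

theorem IsFeature.continuous_reflect (hu : IsFeature h u U V L) (x : Plane) :
    Continuous fun y => u (x - y) :=
  continuous_of_lip (hu.reflect x).lip

/-- Translation invariance of the integral lets the second difference act on `φ`, whose two-sided
bound `D` applies. Of `u` only the sup bound matters, so its modulus `L` does not enter the result.
-/
theorem IsKernel.isSemiconvex_contConv (hφ : IsKernel p h φ F G D) (hh : 0 < h) (hp : 8 ≤ p)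
    (hu : IsFeature h u U V L) :
    IsSemiconvex (contConv h φ u) (3 * h / 2) (9 / 5 * p ^ 2 * D * U) := by
  intro a b ha hb hab z w hw
  have hp' : (8 : ℝ) ≤ p := by exact_mod_cast hp
  have hU : 0 ≤ U := (abs_nonneg _).trans (hu.bound 0)
  have hD := hφ.isC11.nonneg.2.2
  have hc := hu.continuous_reflect z
  have shift (s : Plane) : contConv h φ u (z + s) = (h ^ 2)⁻¹ * ∫ y, φ (y + s) * u (z - y) := by
    rw [contConv, ← MeasureTheory.integral_add_right_eq_self _ s]
    simp only [add_sub_add_right_eq_sub]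
  have hint (s : Plane) : MeasureTheory.Integrable fun y => φ (y + s) * u (z - y) := by
    have := (hφ.integrable_mul (w := fun y => u (z + s - y))
      (hu.continuous_reflect _)).comp_add_right s
    simpa only [add_sub_add_right_eq_sub] using this
  have e : a * contConv h φ u (z + b • w) + b * contConv h φ u (z - a • w) - contConv h φ u z
      = (h ^ 2)⁻¹ * ∫ y, (a * φ (y + b • w) + b * φ (y - a • w) - φ y) * u (z - y) := by
    have h0 : contConv h φ u z = (h ^ 2)⁻¹ * ∫ y, φ y * u (z - y) := rfl
    rw [sub_eq_add_neg z, shift, shift, h0]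
    have i1 := (hint (b • w)).const_mul a
    have i2 := (hint (-(a • w))).const_mul b
    have i3 := hφ.integrable_mul hc
    have i4 : MeasureTheory.Integrable fun y => a * (φ (y + b • w) * u (z - y))
        + b * (φ (y + -(a • w)) * u (z - y)) := i1.add i2
    have : ∫ y, (a * φ (y + b • w) + b * φ (y - a • w) - φ y) * u (z - y)
        = a * (∫ y, φ (y + b • w) * u (z - y)) + b * (∫ y, φ (y + -(a • w)) * u (z - y))
          - ∫ y, φ y * u (z - y) := by
      rw [← MeasureTheory.integral_const_mul, ← MeasureTheory.integral_const_mul,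
        ← MeasureTheory.integral_add i1 i2, ← MeasureTheory.integral_sub i4 i3]
      congr 1
      ext y
      rw [← sub_eq_add_neg]
      ring
    rw [this]
    ring
  -- Shifts of length at most `3h/2` enlarge the support radius from `(p + 1) h / 2` to `(p + 4) h /
  -- 2`; for `p ≥ 8` the area of this disc is at most `9/5 p² h²`. Here the restriction to short
  -- segments is essential.
  have key := abs_integral_le_of_support
    (f := fun y => (a * φ (y + b • w) + b * φ (y - a • w) - φ y) * u (z - y))
    (ρ := ((p : ℝ) + 4) * h / 2) (K := a * b * (D / 2) * ‖w‖ ^ 2 * U) (by positivity)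
    (fun y hy => by
      have n1 : ‖y‖ - 3 * h / 2 ≤ ‖y + b • w‖ := by
        have h1 := norm_sub_norm_le y (-(b • w))
        rw [norm_neg, norm_smul, Real.norm_of_nonneg hb, sub_neg_eq_add] at h1
        nlinarith [norm_nonneg w]
      have n2 : ‖y‖ - 3 * h / 2 ≤ ‖y - a • w‖ := by
        have h1 := norm_sub_norm_le y (a • w)
        rw [norm_smul, Real.norm_of_nonneg ha] at h1
        nlinarith [norm_nonneg w]
      rw [hφ.support _ (by linarith : ((p : ℝ) + 1) * h / 2 ≤ ‖y‖), hφ.support _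
        (by linarith : ((p : ℝ) + 1) * h / 2 ≤ ‖y + b • w‖), hφ.support _
        (by linarith : ((p : ℝ) + 1) * h / 2 ≤ ‖y - a • w‖)]
      simp)
    (fun y _ => by
      rw [abs_mul]
      exact mul_le_mul (hφ.isC11.second a b ha hb hab y w) (hu.bound _) (abs_nonneg _)
        (by positivity))
  have hπ : Real.pi * (((p : ℝ) + 4) / 2) ^ 2 ≤ 9 / 5 * p ^ 2 := by
    have h1 : ((p : ℝ) + 4) ^ 2 ≤ 9 / 4 * p ^ 2 := by nlinarith
    nlinarith [Real.pi_lt_d2, Real.pi_pos]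
  have h2 : 0 < h ^ 2 := by positivity
  have k2 : |(h ^ 2)⁻¹ * ∫ y, (a * φ (y + b • w) + b * φ (y - a • w) - φ y) * u (z - y)|
      ≤ a * b * (9 / 5 * p ^ 2 * D * U / 2) * ‖w‖ ^ 2 := by
    rw [abs_mul, abs_of_pos (inv_pos.2 h2), inv_mul_le_iff₀ h2]
    refine key.trans ?_
    calc a * b * (D / 2) * ‖w‖ ^ 2 * U * (Real.pi * (((p : ℝ) + 4) * h / 2) ^ 2)
        = h ^ 2 * (a * b * (D / 2) * ‖w‖ ^ 2 * U) * (Real.pi * (((p : ℝ) + 4) / 2) ^ 2) := by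
          ring
      _ ≤ h ^ 2 * (a * b * (D / 2) * ‖w‖ ^ 2 * U) * (9 / 5 * p ^ 2) :=
          mul_le_mul_of_nonneg_left hπ (by positivity)
      _ = _ := by ring
  rw [← e] at k2
  linarith [(abs_le.1 k2).1]

theorem IsKernel.isFeature_contConv (hφ : IsKernel p h φ F G D) (hh : 0 < h) (hp : 8 ≤ p)
    (hu : IsFeature h u U V L) :
    IsFeature h (contConv h φ u) (p ^ 2 * F * U) (p ^ 2 * F * V) (9 / 5 * p ^ 2 * D * U) where
  bound x := hφ.abs_integral_mul_le hh hp fun y _ => hu.bound _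
  lip x x' := by
    refine (hφ.abs_integral_mul_sub_le hh hp (hu.continuous_reflect x) (hu.continuous_reflect x')
      (M := V * ‖x - x'‖) fun y _ => ?_).trans_eq (by ring)
    simpa using hu.lip (x - y) (x' - y)
  semiconvex := hφ.isSemiconvex_contConv hh hp hu
  nonneg := by
    have hU : 0 ≤ U := (abs_nonneg _).trans (hu.bound 0)
    have hD := hφ.isC11.nonneg.2.2
    positivity

end Conv

/-! ### One layer: sums over channels and ReLU -/

theorem abs_sum_le_card_mul {ι : Type*} [Fintype ι] {f : ι → ℝ} {M : ℝ} (hf : ∀ i, |f i| ≤ M) :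
    |∑ i, f i| ≤ Fintype.card ι * M := by
  refine (Finset.abs_sum_le_sum_abs _ _).trans ?_
  simpa using Finset.sum_le_sum fun i (_ : i ∈ Finset.univ) => hf i

theorem isFeature_sum {ι : Type*} [Fintype ι] {h U V L : ℝ} {f : ι → Plane → ℝ} (hL : 0 ≤ L)
    (hf : ∀ i, IsFeature h (f i) U V L) :
    IsFeature h (fun x => ∑ i, f i x) (Fintype.card ι * U) (Fintype.card ι * V)
      (Fintype.card ι * L) where
  bound x := abs_sum_le_card_mul fun i => (hf i).bound x
  lip x y := by
    rw [← Finset.sum_sub_distrib, mul_assoc]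
    exact abs_sum_le_card_mul fun i => (hf i).lip x y
  semiconvex a b ha hb hab z w hw := by
    have := Finset.sum_le_sum fun i (_ : i ∈ Finset.univ) =>
      (hf i).semiconvex a b ha hb hab z w hw
    simp only [Finset.sum_add_distrib, ← Finset.mul_sum, Finset.sum_const, Finset.card_univ,
      nsmul_eq_mul] at this
    linarith
  nonneg := by positivity

theorem abs_relu_le (s : ℝ) : |relu s| ≤ |s| := by
  rw [relu, abs_of_nonneg (le_max_right _ _)]
  exact max_le (le_abs_self _) (abs_nonneg _)

theorem abs_relu_sub_relu_le (s t : ℝ) : |relu s - relu t| ≤ |s - t| := by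
  exact abs_max_sub_max_le_abs s t 0

theorem IsFeature.relu {h U V L : ℝ} {f : Plane → ℝ} (hf : IsFeature h f U V L) :
    IsFeature h (fun x => relu (f x)) U V L where
  bound x := (abs_relu_le _).trans (hf.bound x)
  lip x y := (abs_relu_sub_relu_le _ _).trans (hf.lip x y)
  semiconvex := hf.semiconvex.relu hf.nonneg
  nonneg := hf.nonneg

section Layer

variable {ι : Type*} [Fintype ι] {p : ℕ} {h : ℝ} {φ : ι → Plane → ℝ} {F G D U V L : ℝ}

theorem isFeature_sum_contConv {u : ι → Plane → ℝ} (hι : Nonempty ι)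
    (hφ : ∀ i, IsKernel p h (φ i) F G D) (hh : 0 < h) (hp : 8 ≤ p)
    (hu : ∀ i, IsFeature h (u i) U V L) :
    IsFeature h (fun x => ∑ i, contConv h (φ i) (u i) x) (Fintype.card ι * (p ^ 2 * F * U))
      (Fintype.card ι * (p ^ 2 * F * V)) (Fintype.card ι * (9 / 5 * p ^ 2 * D * U)) := by
  have hf i := (hφ i).isFeature_contConv hh hp (hu i)
  exact isFeature_sum (hf hι.some).nonneg hf

theorem abs_discConv_le {φ u : Plane → ℝ} {x : Plane} (hF : 0 ≤ F) (hφ : ∀ y, |φ y| ≤ F)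
    (hu : ∀ y, |u y| ≤ U) : |discConv p h φ u x| ≤ p ^ 2 * F * U := by
  have key (k l : Fin p) : |φ (gridPoint p p h k l) * u (x - gridPoint p p h k l)| ≤ F * U := by
    rw [abs_mul]
    exact mul_le_mul (hφ _) (hu _) (abs_nonneg _) hF
  have := abs_sum_le_card_mul fun k => abs_sum_le_card_mul (key k)
  rw [Fintype.card_fin] at this
  exact this.trans_eq (by ring)

theorem abs_sum_discConv_le {u : ι → Plane → ℝ} (hF : 0 ≤ F) (hφ : ∀ i y, |φ i y| ≤ F)
    (hu : ∀ i y, |u i y| ≤ U) (x : Plane) :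
    |∑ i, discConv p h (φ i) (u i) x| ≤ Fintype.card ι * (p ^ 2 * F * U) :=
  abs_sum_le_card_mul fun i => abs_discConv_le hF (hφ i) (hu i)

theorem discConv_sub (φ u v : Plane → ℝ) (x : Plane) :
    discConv p h φ u x - discConv p h φ v x = discConv p h φ (fun y => u y - v y) x := by
  simp only [discConv, mul_sub, Finset.sum_sub_distrib]

/-- Propagation of the discretisation error through one layer. -/
theorem abs_sum_discConv_sub_sum_contConv_le {u v : ι → Plane → ℝ}
    (hφ : ∀ i, IsKernel p h (φ i) F G D) (hh : 0 < h) (hv : ∀ i, IsFeature h (v i) U V L) {ε : ℝ}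
    (huv : ∀ i y, |u i y - v i y| ≤ ε) (x : Plane) :
    |∑ i, discConv p h (φ i) (u i) x - ∑ i, contConv h (φ i) (v i) x|
      ≤ Fintype.card ι * (p ^ 2 * F * ε
        + ((p + 2) ^ 2 * (G * V / 2 + D * U / 4) + p * (p + 1) / 2 * (G * V)
          + 3 / 4 * p ^ 2 * F * L) * h ^ 2) := by
  rw [← Finset.sum_sub_distrib]
  refine abs_sum_le_card_mul fun i => ?_
  have h1 := abs_discConv_le (p := p) (h := h) (x := x) (hφ i).isC11.nonneg.1 (hφ i).isC11.bound
    (huv i)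
  rw [← discConv_sub] at h1
  have h2 := (hφ i).abs_contConv_sub_discConv_le hh (hv i) x
  rw [abs_sub_comm] at h2
  exact (abs_sub_le _ (discConv p h (φ i) (v i) x) _).trans (add_le_add h1 h2)

end Layer

/-! ### Rotations in finite subgroups of `O(2)` -/

theorem rotO2_val (α : ℝ) : (rotO2 α : Matrix (Fin 2) (Fin 2) ℝ)
    = !![Real.cos α, -Real.sin α; Real.sin α, Real.cos α] := rfl

theorem rotO2_add (α β : ℝ) : rotO2 (α + β) = rotO2 α * rotO2 β := by
  apply Subtype.ext
  rw [Submonoid.coe_mul, rotO2_val, rotO2_val, rotO2_val, Real.cos_add, Real.sin_add]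
  ext i j
  fin_cases i <;> fin_cases j <;> simp [Matrix.mul_apply, Fin.sum_univ_two] <;> ring

theorem rotO2_zero : rotO2 0 = 1 := by
  apply Subtype.ext
  rw [rotO2_val]
  ext i j
  fin_cases i <;> fin_cases j <;> simp

theorem rotO2_nat_mul (m : ℕ) (α : ℝ) : rotO2 (m * α) = rotO2 α ^ m := by
  induction m with
  | zero => simp [rotO2_zero]
  | succ m ih => rw [pow_succ, ← ih, ← rotO2_add]; congr 1; push_cast; ring

theorem rotO2_add_int_mul_two_pi (α : ℝ) (n : ℤ) : rotO2 (α + n * (2 * Real.pi)) = rotO2 α := by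
  apply Subtype.ext
  rw [rotO2_val, rotO2_val, Real.cos_add_int_mul_two_pi, Real.sin_add_int_mul_two_pi]

theorem eq_int_mul_of_rotO2_eq_one {α : ℝ} (h : rotO2 α = 1) :
    ∃ n : ℤ, α = n * (2 * Real.pi) := by
  have h1 : Real.cos α = 1 := by
    have := congrFun (congrFun (congrArg Subtype.val h) 0) 0
    simpa [rotO2_val] using this
  obtain ⟨n, hn⟩ := (Real.cos_eq_one_iff α).1 h1
  exact ⟨n, hn.symm⟩

/-- An orthogonal matrix of determinant one is a rotation. -/
theorem exists_eq_rotO2 (A : O2) (hA : (A : Matrix (Fin 2) (Fin 2) ℝ).det = 1) :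
    ∃ α, A = rotO2 α := by
  have hA1 := (Matrix.mem_orthogonalGroup_iff' (Fin 2) ℝ).1 A.2
  have hA2 := (Matrix.mem_orthogonalGroup_iff (Fin 2) ℝ).1 A.2
  have e00 := congrFun (congrFun hA1 0) 0
  have e01 := congrFun (congrFun hA1 0) 1
  have e11 := congrFun (congrFun hA1 1) 1
  have f00 := congrFun (congrFun hA2 0) 0
  simp [Matrix.mul_apply, Fin.sum_univ_two] at e00 e01 e11 f00
  rw [Matrix.det_fin_two] at hA
  set a := (A : Matrix (Fin 2) (Fin 2) ℝ) 0 0 with ha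
  set b := (A : Matrix (Fin 2) (Fin 2) ℝ) 0 1 with hb
  set c := (A : Matrix (Fin 2) (Fin 2) ℝ) 1 0 with hc
  set d := (A : Matrix (Fin 2) (Fin 2) ℝ) 1 1 with hd
  -- Orthonormality and determinant one give `(a - d)² + (b + c)² = 2 - 2 det = 0`.
  have had : d = a := by nlinarith [sq_nonneg (a - d), sq_nonneg (b + c)]
  have hbc : b = -c := by nlinarith [sq_nonneg (a - d), sq_nonneg (b + c)]
  have hz : ‖(⟨a, c⟩ : ℂ)‖ = 1 := by
    rw [Complex.norm_def, Complex.normSq_mk, Real.sqrt_eq_one]; linarith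
  have hz0 : (⟨a, c⟩ : ℂ) ≠ 0 := norm_ne_zero_iff.1 (by rw [hz]; exact one_ne_zero)
  refine ⟨Complex.arg ⟨a, c⟩, Subtype.ext ?_⟩
  rw [rotO2_val, Complex.cos_arg hz0, Complex.sin_arg, hz]
  ext i j
  fin_cases i <;> fin_cases j <;> simp [← ha, ← hb, ← hc, ← hd, had, hbc]

/-- A chord is no longer than its arc: `2 - 2 cos(α - β) ≤ (α - β)²`. -/
theorem norm_rotO2_sub_le (α β : ℝ) (y : Plane) :
    ‖actO2 (rotO2 α) y - actO2 (rotO2 β) y‖ ≤ |α - β| * ‖y‖ := by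
  refine (sq_le_sq₀ (norm_nonneg _) (by positivity)).1 ?_
  rw [mul_pow, sq_abs, EuclideanSpace.norm_sq_eq, EuclideanSpace.norm_sq_eq]
  simp only [actO2, rotO2_val, Fin.sum_univ_two, Real.norm_eq_abs, sq_abs]
  simp [dotProduct, Fin.sum_univ_two]
  have h1 := Real.one_sub_sq_div_two_le_cos (x := α - β)
  rw [Real.cos_sub] at h1
  have h2 := Real.sin_sq_add_cos_sq α
  have h3 := Real.sin_sq_add_cos_sq β
  calc _ = (2 - 2 * (Real.cos α * Real.cos β + Real.sin α * Real.sin β))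
        * (y 0 ^ 2 + y 1 ^ 2) := by
        linear_combination (y 0 ^ 2 + y 1 ^ 2) * (h2 + h3)
    _ ≤ _ := mul_le_mul_of_nonneg_right (by linarith) (by positivity)

/-- The determinant as a homomorphism on a subgroup of `O(2)`. -/
noncomputable def detHom (S : Subgroup O2) : S →* ℝˣ :=
  MonoidHom.toHomUnits
    { toFun := fun A => ((A : O2) : Matrix (Fin 2) (Fin 2) ℝ).det
      map_one' := by simp
      map_mul' := fun A B => by simp }

theorem detHom_mem (S : Subgroup O2) (A : S) : detHom S A ∈ ({1, -1} : Set ℝˣ) := by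
  have hA := congrArg Matrix.det ((Matrix.mem_orthogonalGroup_iff (Fin 2) ℝ).1 (A : O2).2)
  rw [Matrix.det_mul, Matrix.det_transpose, Matrix.det_one] at hA
  rcases mul_self_eq_one_iff.1 hA with h | h
  · exact Or.inl (Units.ext h)
  · exact Or.inr (Units.ext h)

theorem card_le_two_mul_card_ker (S : Subgroup O2) [Fintype S] :
    Fintype.card S ≤ 2 * Nat.card (detHom S).ker := by
  rw [← Nat.card_eq_fintype_card, ← (detHom S).ker.index_mul_card, Subgroup.index_ker]
  refine Nat.mul_le_mul_right _ ?_
  have hle : Set.ncard ((detHom S).range : Set ℝˣ) ≤ Set.ncard ({1, -1} : Set ℝˣ) :=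
    Set.ncard_le_ncard (by rintro _ ⟨A, rfl⟩; exact detHom_mem S A) (Set.toFinite _)
  exact hle.trans ((Set.ncard_insert_le _ _).trans (by rw [Set.ncard_singleton]))

/-- The rotations in a finite subgroup of `O(2)` of order `t` come within `2 π / t` of any
rotation. -/
theorem exists_norm_rotO2_sub_le (S : Subgroup O2) [Fintype S] (θ : ℝ) :
    ∃ s : S, ∀ y, ‖actO2 (rotO2 θ) y - actO2 (s : O2) y‖
      ≤ 2 * Real.pi / Fintype.card S * ‖y‖ := by
  classical
  set K := (detHom S).ker with hK
  set m := Nat.card K with hm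
  have hm0 : 0 < m := Nat.card_pos
  have hmR : (0 : ℝ) < m := by exact_mod_cast hm0
  have hcard := card_le_two_mul_card_ker S
  let ρ : Fin m → O2 := fun k => rotO2 (2 * Real.pi * k / m)
  let X : Finset O2 := Finset.univ.image ρ
  let Y : Finset O2 := Finset.univ.image fun A : K => ((A : S) : O2)
  have hX : X.card ≤ m := by simpa using Finset.card_image_le (s := Finset.univ) (f := ρ)
  have hY : Y.card = m := by
    rw [Finset.card_image_of_injective _ fun A B h => Subtype.ext (Subtype.ext h),
      Finset.card_univ, hm, Nat.card_eq_fintype_card]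
  have hint (n : ℤ) : rotO2 (2 * Real.pi * n / m) ∈ X := by
    have hlt : (n % m).toNat < m := by
      have := Int.emod_lt_of_pos n (show (0 : ℤ) < m by exact_mod_cast hm0)
      have := Int.emod_nonneg n (show (m : ℤ) ≠ 0 by exact_mod_cast hm0.ne')
      omega
    refine Finset.mem_image.2 ⟨⟨(n % m).toNat, hlt⟩, Finset.mem_univ _, ?_⟩
    have h1 : (((n % m).toNat : ℕ) : ℝ) = ((n % m : ℤ) : ℝ) := by
      have := Int.toNat_of_nonneg
        (Int.emod_nonneg n (show (m : ℤ) ≠ 0 by exact_mod_cast hm0.ne'))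
      exact_mod_cast congrArg (Int.cast : ℤ → ℝ) this
    have h2 : (n : ℝ) = (n % m : ℤ) + m * (n / m : ℤ) := by
      exact_mod_cast (Int.emod_add_mul_ediv n m).symm
    change rotO2 (2 * Real.pi * ((n % m).toNat : ℕ) / m) = _
    rw [h1, ← rotO2_add_int_mul_two_pi _ (n / m)]
    congr 1
    rw [h2]
    field_simp
  have hYX : Y ⊆ X := by
    intro A hA
    obtain ⟨B, -, rfl⟩ := Finset.mem_image.1 hA
    obtain ⟨α, hα⟩ := exists_eq_rotO2 ((B : S) : O2)
      (congrArg Units.val B.2)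
    have hpow : rotO2 (m * α) = 1 := by
      have h1 : B ^ m = 1 := pow_card_eq_one'
      rw [rotO2_nat_mul, ← hα]
      exact_mod_cast congrArg (fun C : K => ((C : S) : O2)) h1
    obtain ⟨n, hn⟩ := eq_int_mul_of_rotO2_eq_one hpow
    have : α = 2 * Real.pi * n / m := by
      rw [eq_div_iff hmR.ne']; linarith
    rw [hα, this]
    exact hint n
  -- The `m` rotations in `S` have order dividing `m`, so they lie among the at most `m` rotations
  -- by multiples of `2π/m`. By counting, they are all of these.
  have hXY : X = Y := (Finset.eq_of_subset_of_card_le hYX (hX.trans hY.ge)).symm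
  have hmem := hint (round (θ * m / (2 * Real.pi)))
  rw [hXY] at hmem
  obtain ⟨B, -, hB⟩ := Finset.mem_image.1 hmem
  refine ⟨B, fun y => ?_⟩
  rw [hB]
  refine (norm_rotO2_sub_le _ _ y).trans (mul_le_mul_of_nonneg_right ?_ (norm_nonneg _))
  have h1 := abs_sub_round (θ * m / (2 * Real.pi))
  have hπ := Real.pi_pos
  have e : θ - 2 * Real.pi * (round (θ * m / (2 * Real.pi)) : ℤ) / m
      = 2 * Real.pi / m * (θ * m / (2 * Real.pi) - (round (θ * m / (2 * Real.pi)) : ℤ)) := by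
    field_simp
  have hpos : 0 < 2 * Real.pi / m := by positivity
  have ht : (0 : ℝ) < Fintype.card S := by exact_mod_cast Fintype.card_pos
  have hcR : (Fintype.card S : ℝ) ≤ 2 * m := by exact_mod_cast hcard
  rw [e, abs_mul, abs_of_pos hpos]
  -- The nearest multiple of `2π/m` is within `π/m`, and `t ≤ 2m` since at least half of `S`
  -- consists of rotations.
  calc 2 * Real.pi / m * _ ≤ 2 * Real.pi / m * (1 / 2) := mul_le_mul_of_nonneg_left h1 hpos.le
    _ = 2 * Real.pi / (2 * m) := by field_simp
    _ ≤ _ := div_le_div_of_nonneg_left (by positivity) ht hcR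

/-! ### The discrete and the continuous network -/

theorem prodF_zero (p : ℕ) (n : ℕ → ℕ) (F : ℕ → ℝ) : prodF 0 p n F = 1 := by
  simp [prodF]

theorem prodF_succ (i p : ℕ) (n : ℕ → ℕ) (F : ℕ → ℝ) :
    prodF (i + 1) p n F = prodF i p n F * ((n i : ℝ) * (p : ℝ) ^ 2 * F (i + 1)) := by
  rw [prodF, Finset.prod_Icc_succ_top (by omega), prodF, Nat.add_sub_cancel]

theorem prodF_nonneg {i : ℕ} (p : ℕ) (n : ℕ → ℕ) {F : ℕ → ℝ}
    (hF : ∀ j ∈ Finset.Icc 1 i, 0 ≤ F j) : 0 ≤ prodF i p n F :=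
  Finset.prod_nonneg fun j hj => mul_nonneg (by positivity) (hF j hj)

theorem channelNumber_zero (N t : ℕ) (c : ℕ → ℕ) : channelNumber N t c 0 = c 0 := by
  simp [channelNumber]

theorem channelNumber_mid {N i : ℕ} (t : ℕ) (c : ℕ → ℕ) (h0 : i ≠ 0) (hi : i ≠ N) :
    channelNumber N t c i = t * c i := by
  simp [channelNumber, h0, hi]

theorem card_prod_eq_channelNumber (S : Subgroup O2) [Fintype S] {N i : ℕ} (c : ℕ → ℕ)
    (h0 : i ≠ 0) (hi : i ≠ N) : (Fintype.card (Fin (c i) × S) : ℝ)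
      = channelNumber N (Fintype.card S) c i := by
  rw [channelNumber_mid _ _ h0 hi, Fintype.card_prod, Fintype.card_fin, mul_comm]

theorem card_fin_eq_channelNumber (N t : ℕ) (c : ℕ → ℕ) :
    (Fintype.card (Fin (c 0)) : ℝ) = channelNumber N t c 0 := by
  rw [channelNumber_zero, Fintype.card_fin]

namespace EquivariantNet

variable {S : Subgroup O2} [Fintype S] {N : ℕ} {c : ℕ → ℕ}

theorem feature_one (g : EquivariantNet S N c) (p : ℕ) (h : ℝ) (r : Latent (c 0))
    (d : Fin (c 1)) (x : Plane) (B : S) :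
    g.feature p h r 1 d x B
      = relu (∑ a, discConv p h (fun y => g.input a d (actO2 (B : O2)⁻¹ y)) (r a) x) := rfl

theorem feature_add_two (g : EquivariantNet S N c) (p : ℕ) (h : ℝ) (r : Latent (c 0)) (i : ℕ)
    (d : Fin (c (i + 2))) (x : Plane) (B : S) :
    g.feature p h r (i + 2) d x B
      = relu (∑ q : Fin (c (i + 1)) × S,
          discConv p h (fun y => g.mid (i + 2) q.2 q.1 d (actO2 (B : O2)⁻¹ y))
            (fun z => g.feature p h r (i + 1) q.1 z (B * q.2)) x) := by
  rw [Fintype.sum_prod_type]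
  rfl

theorem eval_eq (g : EquivariantNet S N c) (p : ℕ) (h : ℝ) (r : Latent (c 0))
    (d : Fin (c N)) (x : Plane) :
    g.eval p h r d x = ∑ q : Fin (c (N - 1)) × S,
      discConv p h (fun y => g.output q.1 d (actO2 (q.2 : O2)⁻¹ y))
        (fun z => g.feature p h r (N - 1) q.1 z q.2) x := by
  rw [Fintype.sum_prod_type]
  rfl

/-- The feature maps of the network in which the sums over the grid are replaced by integrals over
the plane. -/
noncomputable def contFeature (g : EquivariantNet S N c) (h : ℝ) (r : Latent (c 0)) :
    (i : ℕ) → Fin (c i) → Plane → S → ℝ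
  | 0 => fun _ _ _ => 0
  | 1 => fun d x B =>
      relu (∑ a, contConv h (fun y => g.input a d (actO2 (B : O2)⁻¹ y)) (r a) x)
  | i + 2 => fun d x B => relu (∑ q : Fin (c (i + 1)) × S,
      contConv h (fun y => g.mid (i + 2) q.2 q.1 d (actO2 (B : O2)⁻¹ y))
        (fun z => contFeature g h r (i + 1) q.1 z (B * q.2)) x)

/-- The output of the network in which the sums over the grid are replaced by integrals over the
plane. -/
noncomputable def contEval (g : EquivariantNet S N c) (h : ℝ) (r : Latent (c 0)) :
    Latent (c N) :=
  fun d x => ∑ q : Fin (c (N - 1)) × S,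
    contConv h (fun y => g.output q.1 d (actO2 (q.2 : O2)⁻¹ y))
      (fun z => g.contFeature h r (N - 1) q.1 z q.2) x

section TrivialBound

variable {g : EquivariantNet S N c} {p : ℕ} {h U : ℝ} {F : ℕ → ℝ} {r : Latent (c 0)}

/-- Only sup bounds on the filters enter, for an arbitrary nonnegative family `F`, so that a single
`F i` can later be replaced by a bound derived from the Hessian. -/
theorem abs_feature_le (hF : ∀ i ∈ Finset.Icc 1 N, 0 ≤ F i)
    (hin : ∀ a d y, |g.input a d y| ≤ F 1)
    (hmid : ∀ i, 2 ≤ i → i + 1 ≤ N → ∀ A a d y, |g.mid i A a d y| ≤ F i)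
    (hr : ∀ a y, |r a y| ≤ U) (i : ℕ) (hi : i + 2 ≤ N) (d : Fin (c (i + 1))) (x : Plane)
    (B : S) :
    |g.feature p h r (i + 1) d x B|
      ≤ prodF (i + 1) p (channelNumber N (Fintype.card S) c) F * U := by
  induction i generalizing x B with
  | zero =>
    rw [feature_one, prodF_succ, prodF_zero, ← card_fin_eq_channelNumber]
    refine (abs_relu_le _).trans ((abs_sum_discConv_le (hF 1 (Finset.mem_Icc.2 (by omega)))
      (fun a y => hin a d _) hr x).trans_eq ?_)
    ring
  | succ i ih =>
    rw [feature_add_two, prodF_succ,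
      ← card_prod_eq_channelNumber S c (by omega : i + 1 ≠ 0) (by omega : i + 1 ≠ N)]
    have key := abs_sum_discConv_le (p := p) (h := h) (hF (i + 2) (Finset.mem_Icc.2 (by omega)))
      (φ := fun (q : Fin (c (i + 1)) × S) y => g.mid (i + 2) q.2 q.1 d (actO2 (B : O2)⁻¹ y))
      (fun q y => hmid (i + 2) (by omega) (by omega) q.2 q.1 d _)
      (u := fun q z => g.feature p h r (i + 1) q.1 z (B * q.2))
      (fun q y => ih (by omega) q.1 y (B * q.2)) x
    exact (abs_relu_le _).trans (key.trans_eq (by ring))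

theorem abs_eval_le (hN : 2 ≤ N) (hF : ∀ i ∈ Finset.Icc 1 N, 0 ≤ F i)
    (hin : ∀ a d y, |g.input a d y| ≤ F 1)
    (hmid : ∀ i, 2 ≤ i → i + 1 ≤ N → ∀ A a d y, |g.mid i A a d y| ≤ F i)
    (hout : ∀ a d y, |g.output a d y| ≤ F N)
    (hr : ∀ a y, |r a y| ≤ U) (d : Fin (c N)) (x : Plane) :
    |g.eval p h r d x| ≤ prodF N p (channelNumber N (Fintype.card S) c) F * U := by
  obtain ⟨i, rfl⟩ := Nat.exists_eq_add_of_le' hN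
  rw [eval_eq, prodF_succ,
    ← card_prod_eq_channelNumber S c (by omega : i + 1 ≠ 0) (by omega : i + 1 ≠ i + 2)]
  have key := abs_sum_discConv_le (p := p) (h := h) (hF (i + 2) (Finset.mem_Icc.2 (by omega)))
    (φ := fun (q : Fin (c (i + 1)) × S) y => g.output q.1 d (actO2 (q.2 : O2)⁻¹ y))
    (fun q y => hout q.1 d _)
    (u := fun q z => g.feature p h r (i + 1) q.1 z q.2)
    (fun q y => abs_feature_le hF hin hmid hr i le_rfl q.1 y q.2) x
  exact key.trans_eq (by ring)

end TrivialBound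

end EquivariantNet

/-! ### The error budget -/

/-- The sum in the constant `C₁`. -/
noncomputable def errorSum (N : ℕ) (F G D : ℕ → ℝ) : ℝ :=
  ∑ i ∈ Finset.Icc 1 N,
    (D i * F 0 / F i + 2 * (G i / F i) * (∑ m ∈ Finset.Icc 1 (i - 1), G m * F 0 / F m)
      + 2 * (G i * G 0 / F i) + D 0)

theorem constC1_eq (N p : ℕ) (n : ℕ → ℕ) (F G D : ℕ → ℝ) :
    constC1 N p n F G D = 2 * (N : ℝ) * prodF N p n F * errorSum N F G D := rfl

section ErrorSum

variable {N : ℕ} {F G D : ℕ → ℝ}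

theorem errorSum_term_ge (hF : ∀ i ∈ Finset.Icc 1 N, 0 < F i) (hG : ∀ i ≤ N, 0 ≤ G i)
    (hF0 : 0 ≤ F 0) {i : ℕ} (hi : i ∈ Finset.Icc 1 N) :
    D i * F 0 / F i + 2 * (G i * G 0 / F i) + D 0 ≤
      D i * F 0 / F i + 2 * (G i / F i) * (∑ m ∈ Finset.Icc 1 (i - 1), G m * F 0 / F m)
      + 2 * (G i * G 0 / F i) + D 0 := by
  rw [Finset.mem_Icc] at hi
  have : 0 ≤ 2 * (G i / F i) * (∑ m ∈ Finset.Icc 1 (i - 1), G m * F 0 / F m) := by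
    refine mul_nonneg (mul_nonneg two_pos.le (div_nonneg (hG i hi.2)
      (hF i (Finset.mem_Icc.2 hi)).le)) (Finset.sum_nonneg fun m hm => ?_)
    rw [Finset.mem_Icc] at hm
    exact div_nonneg (mul_nonneg (hG m (by omega)) hF0)
      (hF m (Finset.mem_Icc.2 (by omega))).le
  linarith

theorem errorSum_base_nonneg (hF : ∀ i ∈ Finset.Icc 1 N, 0 < F i) (hG : ∀ i ≤ N, 0 ≤ G i)
    (hD : ∀ i ≤ N, 0 ≤ D i) (hF0 : 0 ≤ F 0) {i : ℕ} (hi : i ∈ Finset.Icc 1 N) :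
    0 ≤ D i * F 0 / F i ∧ 0 ≤ G i * G 0 / F i := by
  have := hF i hi
  have h1 := hG i (Finset.mem_Icc.1 hi).2
  have h2 := hD i (Finset.mem_Icc.1 hi).2
  have h3 := hG 0 (Nat.zero_le _)
  constructor <;> positivity

/-- The double sum over `m < i` in `C₁` is nonnegative and is not needed; neither are the layers
outside `s`. -/
theorem errorSum_ge_sum (hF : ∀ i ∈ Finset.Icc 1 N, 0 < F i) (hG : ∀ i ≤ N, 0 ≤ G i)
    (hD : ∀ i ≤ N, 0 ≤ D i) (hF0 : 0 ≤ F 0) {s : Finset ℕ} (hs : s ⊆ Finset.Icc 1 N) :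
    ∑ i ∈ s, (D i * F 0 / F i + 2 * (G i * G 0 / F i) + D 0) ≤ errorSum N F G D := by
  refine (Finset.sum_le_sum_of_subset_of_nonneg hs fun i hi _ => ?_).trans
    (Finset.sum_le_sum fun i hi => errorSum_term_ge hF hG hF0 hi)
  obtain ⟨h1, h2⟩ := errorSum_base_nonneg hF hG hD hF0 hi
  linarith [hD 0 (Nat.zero_le _)]

/-- For `p ≥ 8` one has `(p + 2)² ≤ 25/16 p²` and `p (p + 1) ≤ 9/8 p²`, so the coefficients are at
most `25/64 ≤ 1/2` for `δ` and `25/32 + 9/16 ≤ 2` for `γ`. -/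
theorem layer_error_le {p : ℕ} (hp : 8 ≤ p) {P f γ δ f₀ g₀ X : ℝ} (hf : 0 < f) (hγ : 0 ≤ γ)
    (hδ : 0 ≤ δ) (hf₀ : 0 ≤ f₀) (hg₀ : 0 ≤ g₀) (hP : 0 ≤ P) :
    ((p : ℝ) + 2) ^ 2 * (γ * (P * g₀) / 2 + δ * (P * f₀) / 4)
        + p * (p + 1) / 2 * (γ * (P * g₀)) + 3 / 4 * p ^ 2 * f * (P * X)
      ≤ p ^ 2 * f * P * (1 / 2 * (δ * f₀ / f) + 2 * (γ * g₀ / f) + 3 / 4 * X) := by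
  have hp' : (8 : ℝ) ≤ p := by exact_mod_cast hp
  have e : (p : ℝ) ^ 2 * f * P * (1 / 2 * (δ * f₀ / f) + 2 * (γ * g₀ / f) + 3 / 4 * X)
      = p ^ 2 * (1 / 2 * (P * (δ * f₀)) + 2 * (P * (γ * g₀))) + 3 / 4 * p ^ 2 * f * (P * X) := by
    field_simp
  rw [e]
  have h1 : ((p : ℝ) + 2) ^ 2 ≤ 25 / 16 * p ^ 2 := by nlinarith
  have h2 : (p : ℝ) * (p + 1) ≤ 9 / 8 * p ^ 2 := by nlinarith
  have q1 : 0 ≤ P * (γ * g₀) := by positivity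
  have q2 : 0 ≤ P * (δ * f₀) := by positivity
  have k1 := mul_le_mul_of_nonneg_right h1 q1
  have k2 := mul_le_mul_of_nonneg_right h1 q2
  have k3 := mul_le_mul_of_nonneg_right h2 q1
  have k4 : 0 ≤ (p : ℝ) ^ 2 * (P * (γ * g₀)) := by positivity
  have k5 : 0 ≤ (p : ℝ) ^ 2 * (P * (δ * f₀)) := by positivity
  linarith

end ErrorSum

/-- A kernel is moved by a rotation `s` and the point by a rigid motion with linear part close
to `s`. -/
theorem IsKernel.abs_contConv_motion_le {p : ℕ} {h : ℝ} {φ u u' : Plane → ℝ}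
    {F G D U V L U' V' L' : ℝ} (hφ : IsKernel p h φ F G D) (hh : 0 < h) (hp : 8 ≤ p)
    (hu : IsFeature h u U V L) (hu' : IsFeature h u' U' V' L') {A s : O2} {b : Plane} {ε η : ℝ}
    (hη : ∀ y : Plane, ‖y‖ ≤ ((p : ℝ) + 1) * h / 2 → ‖actO2 A y - actO2 s y‖ ≤ η)
    (huu' : ∀ z, |u' (actO2 A z + b) - u z| ≤ ε) (x : Plane) :
    |contConv h (fun y => φ (actO2 s⁻¹ y)) u' (actO2 A x + b) - contConv h φ u x|
      ≤ p ^ 2 * F * (ε + V * η) := by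
  have hV : 0 ≤ V := by
    obtain ⟨w, hw⟩ := plane_exists_norm_one
    simpa [hw] using (abs_nonneg _).trans (hu.lip w 0)
  have e : contConv h (fun y => φ (actO2 s⁻¹ y)) u' (actO2 A x + b)
      = (h ^ 2)⁻¹ * ∫ y, φ y * u' (actO2 A x + b - actO2 s y) := by
    rw [contConv, ← integral_comp_actO2 s]
    simp only [actO2_inv_self]
  -- After the substitution, `u (x - A⁻¹ s y)` is the intermediate value: `u'` at the moved point
  -- differs from it by at most `ε`, and its argument is within `‖A y - s y‖` of `x - y`.
  rw [e]
  refine hφ.abs_integral_mul_sub_le hh hp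
    ((hu'.continuous_reflect _).comp (continuous_actO2 s)) (hu.continuous_reflect x)
    fun y hy => ?_
  have e2 : actO2 A x + b - actO2 s y = actO2 A (x - actO2 A⁻¹ (actO2 s y)) + b := by
    rw [actO2_sub, actO2_self_inv]; abel
  have h1 := huu' (x - actO2 A⁻¹ (actO2 s y))
  have h2 := hu.lip (x - actO2 A⁻¹ (actO2 s y)) (x - y)
  have h3 : ‖x - actO2 A⁻¹ (actO2 s y) - (x - y)‖ ≤ η := by
    rw [sub_sub_sub_cancel_left, ← norm_actO2 A, actO2_sub, actO2_self_inv]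
    exact hη y hy
  rw [← e2] at h1
  exact (abs_sub_le _ (u (x - actO2 A⁻¹ (actO2 s y))) _).trans
    (add_le_add h1 (h2.trans (mul_le_mul_of_nonneg_left h3 hV)))

/-! ### Discretisation error of the network -/

namespace EquivariantNet

variable {S : Subgroup O2} {N : ℕ} {c : ℕ → ℕ} {g : EquivariantNet S N c} {p : ℕ}
  {h : ℝ} {F G D : ℕ → ℝ} {r : Latent (c 0)}

theorem Bounded.input_isKernel (hg : g.Bounded p h F G D) (a : Fin (c 0)) (d : Fin (c 1))
    (A : O2) : IsKernel p h (fun y => g.input a d (actO2 A y)) (F 1) (G 1) (D 1) :=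
  (hg.1 a d).isKernel.comp_actO2 A

theorem Bounded.mid_isKernel (hg : g.Bounded p h F G D) {i : ℕ} (h2 : 2 ≤ i) (hi : i + 1 ≤ N)
    (B : S) (a : Fin (c (i - 1))) (d : Fin (c i)) (A : O2) :
    IsKernel p h (fun y => g.mid i B a d (actO2 A y)) (F i) (G i) (D i) :=
  (hg.2.1 i h2 hi B a d).isKernel.comp_actO2 A

theorem Bounded.output_isKernel (hg : g.Bounded p h F G D) (a : Fin (c (N - 1)))
    (d : Fin (c N)) (A : O2) :
    IsKernel p h (fun y => g.output a d (actO2 A y)) (F N) (G N) (D N) :=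
  (hg.2.2 a d).isKernel.comp_actO2 A

/-- The signs of the bounds come from an actual function in each layer, hence the need for nonempty
channel sets. -/
theorem Bounded.nonneg (hg : g.Bounded p h F G D)
    (hr : ∀ a, IsC11 (r a) (F 0) (G 0) (D 0)) (hN : 2 ≤ N) (hc : ∀ j ≤ N, 0 < c j) :
    ∀ i ≤ N, 0 ≤ F i ∧ 0 ≤ G i ∧ 0 ≤ D i := by
  intro i hi
  rcases Nat.eq_zero_or_pos i with rfl | h0
  · exact (hr ⟨0, hc 0 hi⟩).nonneg
  rcases (show i = 1 ∨ 2 ≤ i by omega) with rfl | h2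
  · exact (hg.1 ⟨0, hc 0 (by omega)⟩ ⟨0, hc 1 hi⟩).isKernel.isC11.nonneg
  rcases hi.lt_or_eq with hlt | rfl
  · exact (hg.2.1 i h2 hlt 1 ⟨0, hc (i - 1) (by omega)⟩ ⟨0, hc i hi⟩).isKernel.isC11.nonneg
  · exact (hg.2.2 ⟨0, hc (i - 1) (by omega)⟩ ⟨0, hc i hi⟩).isKernel.isC11.nonneg

variable [Fintype S]

theorem contFeature_one (d : Fin (c 1)) (x : Plane) (B : S) :
    g.contFeature h r 1 d x B
      = relu (∑ a, contConv h (fun y => g.input a d (actO2 (B : O2)⁻¹ y)) (r a) x) := rfl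

theorem contFeature_add_two (i : ℕ) (d : Fin (c (i + 2))) (x : Plane) (B : S) :
    g.contFeature h r (i + 2) d x B = relu (∑ q : Fin (c (i + 1)) × S,
      contConv h (fun y => g.mid (i + 2) q.2 q.1 d (actO2 (B : O2)⁻¹ y))
        (fun z => g.contFeature h r (i + 1) q.1 z (B * q.2)) x) := rfl

theorem contFeature_isFeature (hg : g.Bounded p h F G D)
    (hr : ∀ a, IsC11 (r a) (F 0) (G 0) (D 0)) (hF : ∀ i ∈ Finset.Icc 1 N, 0 < F i)
    (hc : ∀ j ≤ N, 0 < c j) (hh : 0 < h) (hp : 8 ≤ p) (i : ℕ) (hi : i + 2 ≤ N)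
    (d : Fin (c (i + 1))) (B : S) :
    IsFeature h (fun x => g.contFeature h r (i + 1) d x B)
      (prodF (i + 1) p (channelNumber N (Fintype.card S) c) F * F 0)
      (prodF (i + 1) p (channelNumber N (Fintype.card S) c) F * G 0)
      (prodF (i + 1) p (channelNumber N (Fintype.card S) c) F
        * (9 / 5 * (D (i + 1) * F 0 / F (i + 1)))) := by
  have hFi : F (i + 1) ≠ 0 := (hF (i + 1) (Finset.mem_Icc.2 (by omega))).ne'
  induction i generalizing B with
  | zero =>
    have key : IsFeature h (fun x => g.contFeature h r (0 + 1) d x B) _ _ _ :=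
      (isFeature_sum_contConv (ι := Fin (c 0)) ⟨⟨0, hc 0 (Nat.zero_le _)⟩⟩
      (fun a => hg.input_isKernel a d (B : O2)⁻¹) hh hp fun a => (hr a).isFeature h).relu
    rw [card_fin_eq_channelNumber N (Fintype.card S)] at key
    rw [prodF_succ, prodF_zero]
    convert key using 1
    · ring
    · ring
    · simp only [zero_add] at hFi ⊢
      field_simp
  | succ i ih =>
    have key := (isFeature_sum_contConv (ι := Fin (c (i + 1)) × S)
      (φ := fun q y => g.mid (i + 2) q.2 q.1 d (actO2 (B : O2)⁻¹ y))
      (u := fun q z => g.contFeature h r (i + 1) q.1 z (B * q.2))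
      ⟨⟨0, hc _ (by omega)⟩, 1⟩
      (fun q => hg.mid_isKernel (by omega) (by omega) q.2 q.1 d (B : O2)⁻¹) hh hp
      fun q => ih (by omega) q.1 (B * q.2)
        (hF (i + 1) (Finset.mem_Icc.2 (by omega))).ne').relu
    rw [card_prod_eq_channelNumber S c (by omega : i + 1 ≠ 0) (by omega : i + 1 ≠ N)] at key
    rw [prodF_succ]
    simp only [contFeature_add_two]
    convert key using 1
    · ring
    · ring
    · field_simp

/-- One step of the discretisation error. -/
theorem layer_step {n : ℝ} (hn : 0 ≤ n) (hp : 8 ≤ p) {P f γ δ f₀ g₀ X α β k T : ℝ} (hf : 0 < f)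
    (hγ : 0 ≤ γ) (hδ : 0 ≤ δ) (hf₀ : 0 ≤ f₀) (hg₀ : 0 ≤ g₀) (hP : 0 ≤ P)
    (hT : 1 / 2 * (δ * f₀ / f) + 2 * (γ * g₀ / f) + 3 / 4 * X + β ≤ T + α) :
    n * (p ^ 2 * f * (P * h ^ 2 * (k * T - α))
        + (((p : ℝ) + 2) ^ 2 * (γ * (P * g₀) / 2 + δ * (P * f₀) / 4)
        + p * (p + 1) / 2 * (γ * (P * g₀)) + 3 / 4 * p ^ 2 * f * (P * X)) * h ^ 2)
      ≤ P * (n * p ^ 2 * f) * h ^ 2 * ((k + 1) * T - β) := by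
  have h1 := layer_error_le hp hf hγ hδ hf₀ hg₀ hP (X := X)
  have h2 := mul_le_mul_of_nonneg_left hT (show 0 ≤ (p : ℝ) ^ 2 * f * P by positivity)
  have h3 := mul_le_mul_of_nonneg_left (h1.trans (show _ ≤ (p : ℝ) ^ 2 * f * P * (T + α - β) by
    linarith)) (show 0 ≤ n * h ^ 2 by positivity)
  linarith

/-- The subtracted term is a reserve. The next layer meets the semiconvexity modulus of this one
with coefficient `3/4 · 9/5 = 27/20`, more than the single copy of `D i * F 0 / F i` in `errorSum`;
the reserve of `1/2` covers the excess. Each layer can afford it, as its own quadrature uses only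
half of its Hessian term. -/
theorem abs_feature_sub_contFeature_le (hg : g.Bounded p h F G D)
    (hr : ∀ a, IsC11 (r a) (F 0) (G 0) (D 0)) (hF : ∀ i ∈ Finset.Icc 1 N, 0 < F i)
    (hc : ∀ j ≤ N, 0 < c j) (hh : 0 < h) (hp : 8 ≤ p) (i : ℕ) (hi : i + 2 ≤ N)
    (d : Fin (c (i + 1))) (x : Plane) (B : S) :
    |g.feature p h r (i + 1) d x B - g.contFeature h r (i + 1) d x B|
      ≤ prodF (i + 1) p (channelNumber N (Fintype.card S) c) F * h ^ 2
        * ((i + 1 : ℕ) * errorSum N F G D - 1 / 2 * (D (i + 1) * F 0 / F (i + 1))) := by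
  have hnn := hg.nonneg hr (by omega) hc
  have hF0 := (hnn 0 (Nat.zero_le _)).1
  have hsum {s : Finset ℕ} (hs : s ⊆ Finset.Icc 1 N) := errorSum_ge_sum hF
    (fun j hj => (hnn j hj).2.1) (fun j hj => (hnn j hj).2.2) hF0 hs
  have hpos {j : ℕ} (hj : j ∈ Finset.Icc 1 N) := errorSum_base_nonneg hF
    (fun j hj => (hnn j hj).2.1) (fun j hj => (hnn j hj).2.2) hF0 hj
  have hD0 := (hnn 0 (Nat.zero_le _)).2.2
  have hG0 := (hnn 0 (Nat.zero_le _)).2.1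
  have hmem {j : ℕ} (h1 : 1 ≤ j) (h2 : j ≤ N) : j ∈ Finset.Icc 1 N := Finset.mem_Icc.2 ⟨h1, h2⟩
  induction i generalizing x B with
  | zero =>
    have key := abs_sum_discConv_sub_sum_contConv_le (ε := 0) (u := r) (v := r)
      (fun a => hg.input_isKernel a d (B : O2)⁻¹) hh (fun a => (hr a).isFeature h)
      (fun a y => by simp) x
    rw [card_fin_eq_channelNumber N (Fintype.card S)] at key
    rw [feature_one, contFeature_one, prodF_succ, prodF_zero]
    refine (abs_relu_sub_relu_le _ _).trans (key.trans ?_)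
    have hs := hsum (s := {1}) (by simpa using hmem le_rfl (by omega))
    rw [Finset.sum_singleton] at hs
    have step := layer_step (h := h) (Nat.cast_nonneg
      (channelNumber N (Fintype.card S) c 0)) hp
      (P := 1) (f := F 1) (γ := G 1) (δ := D 1) (f₀ := F 0) (g₀ := G 0) (X := D 0) (α := 0)
      (β := 1 / 2 * (D 1 * F 0 / F 1)) (k := 0) (T := errorSum N F G D)
      (hF 1 (hmem le_rfl (by omega))) (hnn 1 (by omega)).2.1
      (hnn 1 (by omega)).2.2 hF0 hG0 zero_le_one (by linarith)
    simp only [zero_mul, sub_zero, mul_zero, one_mul, zero_add] at step ⊢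
    push_cast
    rw [one_mul]
    exact step
  | succ i ih =>
    have key := abs_sum_discConv_sub_sum_contConv_le (ι := Fin (c (i + 1)) × S)
      (φ := fun q y => g.mid (i + 2) q.2 q.1 d (actO2 (B : O2)⁻¹ y))
      (u := fun q z => g.feature p h r (i + 1) q.1 z (B * q.2))
      (v := fun q z => g.contFeature h r (i + 1) q.1 z (B * q.2))
      (fun q => hg.mid_isKernel (by omega) (by omega) q.2 q.1 d (B : O2)⁻¹) hh
      (fun q => contFeature_isFeature hg hr hF hc hh hp i (by omega) q.1 (B * q.2))
      (fun q y => ih (by omega) q.1 y (B * q.2)) x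
    rw [card_prod_eq_channelNumber S c (by omega : i + 1 ≠ 0) (by omega : i + 1 ≠ N)] at key
    rw [feature_add_two, contFeature_add_two, prodF_succ]
    refine (abs_relu_sub_relu_le _ _).trans (key.trans ?_)
    have hs := hsum (s := {i + 1, i + 2}) (by
      intro j hj
      rw [Finset.mem_insert, Finset.mem_singleton] at hj
      exact hmem (by omega) (by omega))
    rw [Finset.sum_pair (by omega)] at hs
    have p1 := hpos (hmem (by omega : 1 ≤ i + 1) (by omega))
    refine (layer_step (Nat.cast_nonneg _) hp (hF (i + 2) (hmem (by omega) (by omega)))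
      (hnn (i + 2) (by omega)).2.1 (hnn (i + 2) (by omega)).2.2 hF0 hG0
      (prodF_nonneg _ _ fun j hj => (hF j (by rw [Finset.mem_Icc] at hj ⊢; omega)).le)
      (β := 1 / 2 * (D (i + 2) * F 0 / F (i + 2))) (by linarith)).trans_eq ?_
    push_cast
    ring

theorem abs_eval_sub_contEval_le (hg : g.Bounded p h F G D)
    (hr : ∀ a, IsC11 (r a) (F 0) (G 0) (D 0)) (hF : ∀ i ∈ Finset.Icc 1 N, 0 < F i)
    (hc : ∀ j ≤ N, 0 < c j) (hN : 2 ≤ N) (hh : 0 < h) (hp : 8 ≤ p)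
    (d : Fin (c N)) (x : Plane) :
    |g.eval p h r d x - g.contEval h r d x|
      ≤ prodF N p (channelNumber N (Fintype.card S) c) F * h ^ 2 * (N * errorSum N F G D) := by
  obtain ⟨i, rfl⟩ := Nat.exists_eq_add_of_le' hN
  have hnn := hg.nonneg hr (by omega) hc
  have hF0 := (hnn 0 (Nat.zero_le _)).1
  have hD0 := (hnn 0 (Nat.zero_le _)).2.2
  have hG0 := (hnn 0 (Nat.zero_le _)).2.1
  have hmem {j : ℕ} (h1 : 1 ≤ j) (h2 : j ≤ i + 2) : j ∈ Finset.Icc 1 (i + 2) :=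
    Finset.mem_Icc.2 ⟨h1, h2⟩
  have key := abs_sum_discConv_sub_sum_contConv_le (ι := Fin (c (i + 1)) × S)
    (φ := fun q y => g.output q.1 d (actO2 (q.2 : O2)⁻¹ y))
    (u := fun q z => g.feature p h r (i + 1) q.1 z q.2)
    (v := fun q z => g.contFeature h r (i + 1) q.1 z q.2)
    (fun q => hg.output_isKernel q.1 d (q.2 : O2)⁻¹) hh
    (fun q => contFeature_isFeature hg hr hF hc hh hp i le_rfl q.1 q.2)
    (fun q y => abs_feature_sub_contFeature_le hg hr hF hc hh hp i le_rfl q.1 y q.2) x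
  rw [card_prod_eq_channelNumber S c (by omega : i + 1 ≠ 0) (by omega : i + 1 ≠ i + 2)] at key
  rw [eval_eq, prodF_succ]
  refine key.trans ?_
  have hs := errorSum_ge_sum hF
    (fun j hj => (hnn j hj).2.1) (fun j hj => (hnn j hj).2.2) hF0 (s := {i + 1, i + 2}) (by
    intro j hj
    rw [Finset.mem_insert, Finset.mem_singleton] at hj
    exact hmem (by omega) (by omega))
  rw [Finset.sum_pair (by omega)] at hs
  have p1 := errorSum_base_nonneg hF
    (fun j hj => (hnn j hj).2.1) (fun j hj => (hnn j hj).2.2) hF0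
    (hmem (by omega : 1 ≤ i + 1) (by omega))
  have p2 := errorSum_base_nonneg hF
    (fun j hj => (hnn j hj).2.1) (fun j hj => (hnn j hj).2.2) hF0
    (hmem (by omega : 1 ≤ i + 2) (by omega))
  refine (layer_step (Nat.cast_nonneg _) hp (hF (i + 2) (hmem (by omega) (by omega)))
    (hnn (i + 2) (by omega)).2.1 (hnn (i + 2) (by omega)).2.2 hF0 hG0
    (prodF_nonneg _ _ fun j hj => (hF j (by rw [Finset.mem_Icc] at hj ⊢; omega)).le)
    (β := 0) (by linarith)).trans_eq ?_
  push_cast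
  ring

end EquivariantNet

/-! ### Equivariance of the continuous network -/

namespace EquivariantNet

variable {S : Subgroup O2} {N : ℕ} {c : ℕ → ℕ} {g : EquivariantNet S N c} {p : ℕ}
  {h : ℝ} {F G D : ℕ → ℝ} {r : Latent (c 0)}

theorem isC11_transform (hr : ∀ a, IsC11 (r a) (F 0) (G 0) (D 0)) (θ : ℝ) (b : Plane)
    (a : Fin (c 0)) : IsC11 (transform θ b r a) (F 0) (G 0) (D 0) :=
  (hr a).comp_actO2 (rotO2 θ)⁻¹ b

theorem transform_motion (r : Latent (c 0)) (θ : ℝ) (b : Plane) (a : Fin (c 0)) (z : Plane) :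
    transform θ b r a (actO2 (rotO2 θ) z + b) = r a z := by
  rw [transform, add_sub_cancel_right, actO2_inv_self]

theorem actO2_inv_mul (s B : S) (y : Plane) :
    actO2 (((s * B : S) : O2))⁻¹ y = actO2 (B : O2)⁻¹ (actO2 (s : O2)⁻¹ y) := by
  rw [Subgroup.coe_mul, mul_inv_rev, actO2_mul]

variable [Fintype S]

/-- Induction with the group variable shifted from `B` to `s B`. The filter's argument then gains a
factor `s⁻¹`, undone by a change of variables, and associativity turns `(s B) A` into `s (B A)` for
the previous layer. -/
theorem abs_contFeature_motion_le (hg : g.Bounded p h F G D)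
    (hr : ∀ a, IsC11 (r a) (F 0) (G 0) (D 0)) (hF : ∀ i ∈ Finset.Icc 1 N, 0 < F i)
    (hc : ∀ j ≤ N, 0 < c j) (hh : 0 < h) (hp : 8 ≤ p) {θ η : ℝ} {b : Plane} {s : S}
    (hη : ∀ y : Plane, ‖y‖ ≤ ((p : ℝ) + 1) * h / 2 →
      ‖actO2 (rotO2 θ) y - actO2 (s : O2) y‖ ≤ η) (i : ℕ) (hi : i + 2 ≤ N)
    (d : Fin (c (i + 1))) (x : Plane) (B : S) :
    |g.contFeature h (transform θ b r) (i + 1) d (actO2 (rotO2 θ) x + b) (s * B)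
        - g.contFeature h r (i + 1) d x B|
      ≤ (i + 1 : ℕ) * (prodF (i + 1) p (channelNumber N (Fintype.card S) c) F * G 0 * η) := by
  have hr' := isC11_transform hr θ b
  induction i generalizing x B with
  | zero =>
    rw [contFeature_one, contFeature_one, prodF_succ, prodF_zero,
      ← card_fin_eq_channelNumber N (Fintype.card S)]
    refine (abs_relu_sub_relu_le _ _).trans ?_
    rw [← Finset.sum_sub_distrib]
    simp only [actO2_inv_mul]
    refine (abs_sum_le_card_mul fun a => (hg.input_isKernel a d (B : O2)⁻¹).abs_contConv_motion_le
      hh hp ((hr a).isFeature h) ((hr' a).isFeature h) hη (ε := 0)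
      (fun z => by rw [transform_motion, sub_self, abs_zero]) x).trans_eq ?_
    push_cast
    ring
  | succ i ih =>
    rw [contFeature_add_two, contFeature_add_two, prodF_succ,
      ← card_prod_eq_channelNumber S c (by omega : i + 1 ≠ 0) (by omega : i + 1 ≠ N)]
    refine (abs_relu_sub_relu_le _ _).trans ?_
    rw [← Finset.sum_sub_distrib]
    simp only [actO2_inv_mul]
    refine (abs_sum_le_card_mul fun q : Fin (c (i + 1)) × S =>
      (hg.mid_isKernel (by omega) (by omega) q.2 q.1 d (B : O2)⁻¹).abs_contConv_motion_le
      hh hp (contFeature_isFeature hg hr hF hc hh hp i (by omega) q.1 (B * q.2))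
      (contFeature_isFeature hg hr' hF hc hh hp i (by omega) q.1 (s * B * q.2)) hη
      (fun z => by rw [mul_assoc]; exact ih (by omega) q.1 z (B * q.2)) x).trans_eq ?_
    push_cast
    ring

/-- The output of the continuous network is equivariant up to the distance of the rotation from
the group. -/
theorem abs_contEval_motion_le (hg : g.Bounded p h F G D)
    (hr : ∀ a, IsC11 (r a) (F 0) (G 0) (D 0)) (hF : ∀ i ∈ Finset.Icc 1 N, 0 < F i)
    (hc : ∀ j ≤ N, 0 < c j) (hN : 2 ≤ N) (hh : 0 < h) (hp : 8 ≤ p) {θ η : ℝ} {b : Plane} {s : S}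
    (hη : ∀ y : Plane, ‖y‖ ≤ ((p : ℝ) + 1) * h / 2 →
      ‖actO2 (rotO2 θ) y - actO2 (s : O2) y‖ ≤ η) (d : Fin (c N)) (x : Plane) :
    |g.contEval h (transform θ b r) d (actO2 (rotO2 θ) x + b) - g.contEval h r d x|
      ≤ N * (prodF N p (channelNumber N (Fintype.card S) c) F * G 0 * η) := by
  obtain ⟨i, rfl⟩ := Nat.exists_eq_add_of_le' hN
  have hr' := isC11_transform hr θ b
  have e : g.contEval h (transform θ b r) d (actO2 (rotO2 θ) x + b)
      = ∑ q : Fin (c (i + 1)) × S,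
        contConv h (fun y => g.output q.1 d (actO2 (q.2 : O2)⁻¹ (actO2 (s : O2)⁻¹ y)))
          (fun z => g.contFeature h (transform θ b r) (i + 1) q.1 z (s * q.2))
          (actO2 (rotO2 θ) x + b) := by
    -- Left multiplication by `s` permutes `S`, so the output sum may be reindexed by `B ↦ s B`.
    simp only [← actO2_inv_mul]
    exact ((Equiv.prodCongr (Equiv.refl (Fin (c (i + 1)))) (Equiv.mulLeft s)).sum_comp
      fun q : Fin (c (i + 1)) × S =>
        contConv h (fun y => g.output q.1 d (actO2 (q.2 : O2)⁻¹ y))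
          (fun z => g.contFeature h (transform θ b r) (i + 1) q.1 z q.2)
          (actO2 (rotO2 θ) x + b)).symm
  have e' : g.contEval h r d x = ∑ q : Fin (c (i + 1)) × S,
      contConv h (fun y => g.output q.1 d (actO2 (q.2 : O2)⁻¹ y))
        (fun z => g.contFeature h r (i + 1) q.1 z q.2) x := rfl
  rw [e, e', prodF_succ, ← Finset.sum_sub_distrib,
    ← card_prod_eq_channelNumber S c (by omega : i + 1 ≠ 0) (by omega : i + 1 ≠ i + 2)]
  refine (abs_sum_le_card_mul fun q : Fin (c (i + 1)) × S =>
    (hg.output_isKernel q.1 d (q.2 : O2)⁻¹).abs_contConv_motion_le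
    hh hp (contFeature_isFeature hg hr hF hc hh hp i le_rfl q.1 q.2)
    (contFeature_isFeature hg hr' hF hc hh hp i le_rfl q.1 (s * q.2)) hη
    (fun z => abs_contFeature_motion_le hg hr hF hc hh hp hη i le_rfl q.1 z q.2) x).trans_eq ?_
  push_cast
  ring

/-- The equivariance error of a network with large kernels. -/
theorem abs_eval_motion_le (hg : g.Bounded p h F G D)
    (hr : ∀ a, IsC11 (r a) (F 0) (G 0) (D 0)) (hF : ∀ i ∈ Finset.Icc 1 N, 0 < F i)
    (hc : ∀ j ≤ N, 0 < c j) (hN : 2 ≤ N) (hh : 0 < h) (hp : 8 ≤ p) (θ : ℝ) (b : Plane)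
    (d : Fin (c N)) (x : Plane) :
    |g.eval p h (transform θ b r) d (actO2 (rotO2 θ) x + b) - g.eval p h r d x|
      ≤ constC1 N p (channelNumber N (Fintype.card S) c) F G D * h ^ 2
        + 4 * Real.pi * N * G 0 * prodF N p (channelNumber N (Fintype.card S) c) F
          * p * h * (Fintype.card S : ℝ)⁻¹ := by
  obtain ⟨s, hs⟩ := exists_norm_rotO2_sub_le S θ
  have hr' := isC11_transform hr θ b
  have hG0 := (hr ⟨0, hc 0 (Nat.zero_le _)⟩).nonneg.2.1
  have hP : 0 ≤ prodF N p (channelNumber N (Fintype.card S) c) F :=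
    prodF_nonneg _ _ fun j hj => (hF j hj).le
  have hp' : (8 : ℝ) ≤ p := by exact_mod_cast hp
  have ht : (0 : ℝ) < Fintype.card S := by exact_mod_cast Fintype.card_pos
  have hπ := Real.pi_pos
  have hη (y : Plane) (hy : ‖y‖ ≤ ((p : ℝ) + 1) * h / 2) :
      ‖actO2 (rotO2 θ) y - actO2 (s : O2) y‖ ≤ 2 * Real.pi / Fintype.card S * (p * h) := by
    refine (hs y).trans (mul_le_mul_of_nonneg_left (hy.trans ?_) (by positivity))
    nlinarith
  have k1 := abs_eval_sub_contEval_le hg hr' hF hc hN hh hp d (actO2 (rotO2 θ) x + b)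
  have k2 := abs_eval_sub_contEval_le hg hr hF hc hN hh hp d x
  have k3 := abs_contEval_motion_le hg hr hF hc hN hh hp hη (b := b) d x
  rw [abs_sub_comm] at k2
  have k4 : N * (prodF N p (channelNumber N (Fintype.card S) c) F * G 0
        * (2 * Real.pi / Fintype.card S * (p * h)))
      ≤ 4 * Real.pi * N * G 0 * prodF N p (channelNumber N (Fintype.card S) c) F
          * p * h * (Fintype.card S : ℝ)⁻¹ := by
    rw [div_eq_mul_inv]
    have : 0 ≤ Real.pi * N * G 0 * prodF N p (channelNumber N (Fintype.card S) c) F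
          * p * h * (Fintype.card S : ℝ)⁻¹ := by positivity
    linarith
  rw [constC1_eq]
  have t1 := abs_sub_le (g.eval p h (transform θ b r) d (actO2 (rotO2 θ) x + b))
    (g.contEval h (transform θ b r) d (actO2 (rotO2 θ) x + b)) (g.eval p h r d x)
  have t2 := abs_sub_le (g.contEval h (transform θ b r) d (actO2 (rotO2 θ) x + b))
    (g.contEval h r d x) (g.eval p h r d x)
  linarith

/-! ### Small kernels -/

theorem prodF_update {n : ℕ → ℕ} {i : ℕ} (hi : i ∈ Finset.Icc 1 N) (M : ℝ) :
    prodF N p n (Function.update F i M) * F i = prodF N p n F * M := by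
  classical
  simp only [prodF, Finset.prod_mul_distrib]
  rw [Finset.prod_update_of_mem hi, ← Finset.mul_prod_erase _ F hi,
    Finset.sdiff_singleton_eq_erase]
  ring

/-- For small kernels the bounds on the Hessians of the kernels bound the output. -/
theorem abs_eval_le_hessian (hg : g.Bounded p h F G D)
    (hr : ∀ a, IsC11 (r a) (F 0) (G 0) (D 0)) (hF : ∀ i ∈ Finset.Icc 1 N, 0 < F i)
    (hc : ∀ j ≤ N, 0 < c j) (hN : 2 ≤ N) (hh : 0 < h) (d : Fin (c N)) (x : Plane)
    {i : ℕ} (hi : i ∈ Finset.Icc 1 N) :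
    |g.eval p h r d x| ≤ prodF N p (channelNumber N (Fintype.card S) c) F
      * (((p : ℝ) + 1) ^ 2 * h ^ 2 / 16) * (D i * F 0 / F i) := by
  have hnn := hg.nonneg hr hN hc
  set R := ((p : ℝ) + 1) * h / 2 with hR
  have hR0 : 0 < R := by positivity
  -- In layer `i` alone the sup bound is replaced by the `O(h²)` bound forced by compact support.
  set F' := Function.update F i (D i * R ^ 2 / 4) with hF'
  have hbound {j : ℕ} {φ : Plane → ℝ} (hφ : FilterBound p h φ (F j) (G j) (D j)) (y : Plane) :
      |φ y| ≤ F' j := by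
    by_cases hj : j = i
    · subst hj
      rw [hF', Function.update_self]
      exact hφ.1.abs_le_of_support hR0 hφ.2 y
    · rw [hF', Function.update_of_ne hj]
      exact (hφ.1.2 y).1
  have hF'0 : ∀ j ∈ Finset.Icc 1 N, 0 ≤ F' j := fun j hj => by
    by_cases hji : j = i
    · subst hji
      rw [hF', Function.update_self]
      have := (hnn j (Finset.mem_Icc.1 hj).2).2.2
      positivity
    · rw [hF', Function.update_of_ne hji]
      exact (hF j hj).le
  have key := abs_eval_le (g := g) (p := p) (h := h) hN hF'0 (fun a d y => hbound (hg.1 a d) y)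
    (fun j h2 hj A a d y => hbound (hg.2.1 j h2 hj A a d) y)
    (fun a d y => hbound (hg.2.2 a d) y) (fun a y => (hr a).bound y) d x
  refine key.trans_eq ?_
  have hu := prodF_update (p := p) (n := channelNumber N (Fintype.card S) c) (F := F) hi
    (D i * R ^ 2 / 4)
  have hFi := (hF i hi).ne'
  rw [eq_div_of_mul_eq hFi hu, hR]
  field_simp
  ring

/-- Since `(p + 1)² / 16 ≤ 4`, every layer gives a bound on the output; averaging these over all `N`
layers produces the sum in `C₁` with factor `4 / N ≤ N`, which uses `N ≥ 2`. -/
theorem abs_eval_le_of_small (hg : g.Bounded p h F G D)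
    (hr : ∀ a, IsC11 (r a) (F 0) (G 0) (D 0)) (hF : ∀ i ∈ Finset.Icc 1 N, 0 < F i)
    (hc : ∀ j ≤ N, 0 < c j) (hN : 2 ≤ N) (hh : 0 < h) (hp : p ≤ 7) (d : Fin (c N)) (x : Plane) :
    |g.eval p h r d x|
      ≤ constC1 N p (channelNumber N (Fintype.card S) c) F G D * h ^ 2 / 2 := by
  have hnn := hg.nonneg hr hN hc
  have hF0 := (hnn 0 (Nat.zero_le _)).1
  have hP : 0 ≤ prodF N p (channelNumber N (Fintype.card S) c) F :=
    prodF_nonneg _ _ fun j hj => (hF j hj).le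
  have hpos {j : ℕ} (hj : j ∈ Finset.Icc 1 N) := errorSum_base_nonneg hF
    (fun j hj => (hnn j hj).2.1) (fun j hj => (hnn j hj).2.2) hF0 hj
  have hD0 := (hnn 0 (Nat.zero_le _)).2.2
  have hp' : ((p : ℝ) + 1) ^ 2 ≤ 64 := by
    have : (p : ℝ) ≤ 7 := by exact_mod_cast hp
    nlinarith [(Nat.cast_nonneg p : (0 : ℝ) ≤ p)]
  have hN' : (2 : ℝ) ≤ N := by exact_mod_cast hN
  set P := prodF N p (channelNumber N (Fintype.card S) c) F
  set T := errorSum N F G D with hTdef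
  have hT : ∑ i ∈ Finset.Icc 1 N, D i * F 0 / F i ≤ T :=
    (Finset.sum_le_sum fun i hi => by linarith [(hpos hi).2]).trans
      (errorSum_ge_sum hF (fun j hj => (hnn j hj).2.1) (fun j hj => (hnn j hj).2.2) hF0 subset_rfl)
  have hT0 : 0 ≤ T := (Finset.sum_nonneg fun i hi => (hpos hi).1).trans hT
  have hX := Finset.sum_le_sum fun i (hi : i ∈ Finset.Icc 1 N) =>
    (abs_eval_le_hessian hg hr hF hc hN hh d x hi).trans
      (show _ ≤ 4 * P * h ^ 2 * (D i * F 0 / F i) from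
        mul_le_mul_of_nonneg_right (by
          have := mul_le_mul_of_nonneg_left hp' (show 0 ≤ P * h ^ 2 by positivity)
          linarith) (hpos hi).1)
  rw [Finset.sum_const, Nat.card_Icc, Nat.add_sub_cancel, nsmul_eq_mul, ← Finset.mul_sum] at hX
  have hX' := hX.trans (mul_le_mul_of_nonneg_left hT (by positivity))
  rw [constC1_eq, ← hTdef]
  have hQ : 0 ≤ P * h ^ 2 * T := by positivity
  have hN2 : (4 : ℝ) ≤ N * N := by nlinarith
  have h1 := mul_le_mul_of_nonneg_right hN2 hQ
  have h2 : (N : ℝ) * |g.eval p h r d x| ≤ N * (2 * N * P * T * h ^ 2 / 2) := by linarith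
  exact le_of_mul_le_mul_left h2 (by linarith)

theorem prodF_eq_zero {j : ℕ} (hj : j < N) (t : ℕ) (hc : c j = 0) (F : ℕ → ℝ) :
    prodF N p (channelNumber N t c) F = 0 := by
  refine Finset.prod_eq_zero (i := j + 1) (Finset.mem_Icc.2 (by omega)) ?_
  have : channelNumber N t c j = 0 := by
    rw [channelNumber, hc]
    simp
  rw [Nat.add_sub_cancel, this]
  simp

end EquivariantNet

/-! ### Assembly -/

theorem mainTheorem2
    (S : Subgroup O2) [Fintype S] (t : ℕ) (ht : Fintype.card S = t)
    (N : ℕ) (hN : 2 ≤ N) (c : ℕ → ℕ) (H W p : ℕ) (hp : 1 ≤ p) (h : ℝ) (hh : 0 < h)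
    (F G D : ℕ → ℝ) (hF : ∀ i ∈ Finset.Icc 1 N, 0 < F i)
    (g : EquivariantNet S N c) (hg : g.Bounded p h F G D)
    (r : Latent (c 0)) (hr : ∀ a, BoundedC2 (r a) (F 0) (G 0) (D 0))
    (θ : ℝ) (hθ : θ ∈ Set.Icc 0 (2 * Real.pi)) (b : Plane)
    (k : Fin H) (l : Fin W) (d : Fin (c N)) :
    |sample H W h (transformInv θ b (g.eval p h (transform θ b r))) k l d
        - sample H W h (g.eval p h r) k l d|
      ≤ constC1 N p (channelNumber N t c) F G D * h ^ 2
        + constC2 N p H W (channelNumber N t c) F G * (p : ℝ) * h * (t : ℝ)⁻¹ := by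
  subst ht
  have hr₁ a := (hr a).isC11
  have hr₂ := EquivariantNet.isC11_transform hr₁ θ b
  simp only [sample, transformInv]
  set x := gridPoint H W h k l
  -- If some layer before the output has no channels, then `prodF` is zero, and the trivial bound
  -- makes both outputs vanish.
  by_cases hc : ∀ j < N, 0 < c j
  · have hc' : ∀ j ≤ N, 0 < c j := fun j hj => by
      rcases hj.lt_or_eq with hj | rfl
      · exact hc j hj
      · exact d.pos
    have hG0 := (hr₁ ⟨0, hc' 0 (Nat.zero_le _)⟩).nonneg.2.1
    have hP : 0 ≤ prodF N p (channelNumber N (Fintype.card S) c) F :=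
      prodF_nonneg _ _ fun j hj => (hF j hj).le
    have hπ := Real.pi_pos
    -- Only the `2N` part of `C₂` is used; the summand with `max H W` is just nonnegative, because
    -- latent functions are compared at exact points of the plane.
    have hC2 : 4 * Real.pi * N * G 0 * prodF N p (channelNumber N (Fintype.card S) c) F
        ≤ constC2 N p H W (channelNumber N (Fintype.card S) c) F G := by
      have : 0 ≤ 2 * Real.pi * G 0 * prodF N p (channelNumber N (Fintype.card S) c) F
          * (2 * max (H : ℝ) W * (p : ℝ)⁻¹) := by
        have : (0 : ℝ) ≤ max (H : ℝ) W := le_max_of_le_left (Nat.cast_nonneg H)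
        positivity
      rw [constC2]
      linarith
    have hC2' := mul_le_mul_of_nonneg_right (mul_le_mul_of_nonneg_right
      (mul_le_mul_of_nonneg_right hC2 (Nat.cast_nonneg p)) hh.le)
      (inv_nonneg.2 (Nat.cast_nonneg (Fintype.card S)))
    rcases le_or_gt 8 p with h8 | h8
    · exact (EquivariantNet.abs_eval_motion_le hg hr₁ hF hc' hN hh h8 θ b d x).trans
        (add_le_add_right hC2' _)
    · have k1 := EquivariantNet.abs_eval_le_of_small hg hr₁ hF hc' hN hh (by omega) d x
      have k2 := EquivariantNet.abs_eval_le_of_small hg hr₂ hF hc' hN hh (by omega) d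
        (actO2 (rotO2 θ) x + b)
      have k3 : 0 ≤ 4 * Real.pi * N * G 0 * prodF N p (channelNumber N (Fintype.card S) c) F
          * p * h * (Fintype.card S : ℝ)⁻¹ := by positivity
      have k4 := abs_sub (g.eval p h (transform θ b r) d (actO2 (rotO2 θ) x + b))
        (g.eval p h r d x)
      linarith
  · push Not at hc
    obtain ⟨j, hj, hcj⟩ := hc
    have hP := EquivariantNet.prodF_eq_zero (p := p) hj (Fintype.card S)
      (Nat.le_zero.1 hcj) F
    have hzero {r' : Latent (c 0)} (hr' : ∀ a, IsC11 (r' a) (F 0) (G 0) (D 0)) (x : Plane) :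
        g.eval p h r' d x = 0 := by
      have := EquivariantNet.abs_eval_le (g := g) (p := p) (h := h) hN
        (fun i hi => (hF i hi).le) (fun a d y => ((hg.1 a d).1.2 y).1)
        (fun i h2 hi A a d y => ((hg.2.1 i h2 hi A a d).1.2 y).1)
        (fun a d y => ((hg.2.2 a d).1.2 y).1) (fun a y => (hr' a).bound y) d x
      rw [hP, zero_mul] at this
      exact abs_nonpos_iff.1 this
    rw [hzero hr₁, hzero hr₂, constC1_eq, constC2, hP]
    simp
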